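/- Let $n\ge 1$ and $\tau>0$. Let $H_{2n+1}$ be the Heisenberg group of the matrices $\begin{pmatrix}1&x^T&z\\0&E&y\\0&0&1\end{pmatrix}$, $x,y\in\mathbb R^n$, $z\in\mathbb R$, with coordinates $(x_1,\dots,x_n,y_1,\dots,y_n,z)$. Let $g_\tau$ be the left-invariant Riemannian metric $$[g_{ij}(x,y,z)]=\begin{pmatrix}E&0&0\\0&\tau xx^T+E&-\tau x\\0&-\tau x^T&\tau\end{pmatrix},$$ and let $\mathcal D_R$ be the right-invariant distribution obtained by right translations from the span of $\partial_{x_k},\partial_{y_k}$ $(1\le k\le n)$ at the identity; it is spanned by the fields $\partial_{x_k}+y_k\partial_z$, $\partial_{y_k}$ and is the kernel of $\theta=dz-\sum_k y_k\,dx_k$. On $T^*H_{2n+1}$ use the canonical coordinates $(x,y,z,\lambda_1,\dots,\lambda_{2n+1})$ and the canonical Poisson bracket $\{f,h\}=\sum_i\left(\frac{\partial f}{\partial q_i}\frac{\partial h}{\partial\lambda_i}-\frac{\partial f}{\partial\lambda_i}\frac{\partial h}{\partial q_i}\right)$, where $(q_1,\dots,q_{2n+1})=(x,y,z)$. Put $q=(x,y)$,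 $u=(y,0)\in\mathbb R^{2n}$, $\bar\lambda=(\lambda_1,\dots,\lambda_{2n})$, $J=\begin{pmatrix}0&-E\\E&0\end{pmatrix}$, and $$H=\tfrac12\Big(\bar\lambda^T\big(E-\tfrac{\tau}{1+\tau\langle q,q\rangle}(Jq)(Jq)^T\big)\bar\lambda+2\lambda_{2n+1}\bar\lambda^T\big(u+\tfrac{\tau\langle u,u\rangle}{1+\tau\langle q,q\rangle}Jq\big)+\lambda_{2n+1}^2\big(\langle u,u\rangle-\tfrac{\tau\langle u,u\rangle^2}{1+\tau\langle q,q\rangle}\big)\Big).$$ (a) The geodesic flow of the sub-Riemannian structure $(\mathcal D_R,g_\tau|_{\mathcal D_R})$ is the Hamiltonian system on $T^*H_{2n+1}$ with Hamiltonian $H$. That is, $H$ is the sub-Riemannian Hamiltonian $H(a,\lambda)=\frac12\lambda(\beta_a\lambda)$ for $a\in H_{2n+1}$ and $\lambda\in T_a^*H_{2n+1}$, where $\beta_a:T_a^*H_{2n+1}\to T_aH_{2n+1}$ is the linear map with image $(\mathcal D_R)_a$ and $\lambda(v)=g_\tau(\beta_a\lambda,v)$ for $v\in(\mathcal D_R)_a$;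 and on every open interval the normal geodesics (the horizontal curves that satisfy, for some multiplier $\mu(t)$, the Euler–Lagrange equations of $\frac12g_\tau(\dot\gamma,\dot\gamma)+\mu\,\theta(\dot\gamma)$) are exactly the projections of the solutions of Hamilton's equations of $H$. (b) The following functions are smooth first integrals of this system, that is, they Poisson-commute with $H$, and their differentials are linearly independent at almost every point of $T^*H_{2n+1}$: $$I_0=H,\qquad I_j=x_j\lambda_{n+j}-y_j\lambda_j+\tfrac12(x_j^2-y_j^2)\lambda_{2n+1}\quad(1\le j\le n),$$ $$I_{n+k}=(y_{k+1}\lambda_1-x_1\lambda_{n+k+1}+x_{k+1}\lambda_{n+1}-y_1\lambda_{k+1})^2+\big(x_1\lambda_{k+1}-x_{k+1}\lambda_1-y_1\lambda_{n+k+1}+y_{k+1}\lambda_{n+1}+(x_1y_{k+1}-x_{k+1}y_1)\lambda_{2n+1}\big)^2\quad(1\le k\le n-1),$$ $$I_{2n}=\lambda_{2n+1},\qquad I_{2n+l}=\{I_{n+1},I_{n+l+1}\}\quad(1\le l\le n-2).$$ (c) The system is integrable by means of these integrals: let $\mathcal F$ be the Lie algebra of functions (under the Poisson bracket) that they generate.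 Then $\mathcal F$ consists of smooth first integrals and is complete, that is, on an open dense set of points $s\in T^*H_{2n+1}$ the dimension of $F_s=\operatorname{span}\{df(s):f\in\mathcal F\}$ and the dimension of the kernel of the restriction of the Poisson tensor to $F_s$ are constant, and their sum is $\dim T^*H_{2n+1}=4n+2$. If $n=1$ or $n=2$, the integrals listed in (b) commute pairwise. -/

import Mathlib

open scoped Matrix ContDiff

noncomputable section

namespace Heis

/-! ### Canonical Hamiltonian mechanics on `T*ℝ^ι = ℝ^ι × ℝ^ι`

Points of the cotangent bundle are pairs `(q, p)`; a covector is given by its coordinates, and its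
pairing with a tangent vector is the dot product. -/

section Mechanics

variable {ι : Type} [Fintype ι] [DecidableEq ι]

/-- The partial derivative `∂f/∂q_i` of a function of `(q, p)`. -/
def partialFst (i : ι) (f : (ι → ℝ) × (ι → ℝ) → ℝ) (s : (ι → ℝ) × (ι → ℝ)) : ℝ :=
  fderiv ℝ f s (Pi.single i 1, 0)

/-- The partial derivative `∂f/∂p_i` of a function of `(q, p)`. -/
def partialSnd (i : ι) (f : (ι → ℝ) × (ι → ℝ) → ℝ) (s : (ι → ℝ) × (ι → ℝ)) : ℝ :=
  fderiv ℝ f s (0, Pi.single i 1)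

/-- The canonical Poisson tensor `Λ`, as a pairing of covectors of the phase space (it has constant
coefficients in canonical coordinates). -/
def poissonTensor (α β : (ι → ℝ) × (ι → ℝ) →L[ℝ] ℝ) : ℝ :=
  ∑ i, (α (Pi.single i 1, 0) * β (0, Pi.single i 1) - α (0, Pi.single i 1) * β (Pi.single i 1, 0))

/-- `{f, g} = Λ(df, dg) = ∑ i, ∂f/∂q_i ∂g/∂p_i - ∂f/∂p_i ∂g/∂q_i`. -/
def poissonBracket (f g : (ι → ℝ) × (ι → ℝ) → ℝ) (s : (ι → ℝ) × (ι → ℝ)) : ℝ :=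
  poissonTensor (fderiv ℝ f s) (fderiv ℝ g s)

/-- The curve `t ↦ (q(t), p(t))` solves Hamilton's equations on `T`:
`q_i' = ∂H/∂p_i`, `p_i' = -∂H/∂q_i`. -/
def IsHamiltonianTrajectory (H : (ι → ℝ) × (ι → ℝ) → ℝ) (T : Set ℝ)
    (q p : ℝ → ι → ℝ) : Prop :=
  ∀ t ∈ T, ∀ i,
    HasDerivAt (fun s => q s i) (partialSnd i H (q t, p t)) t ∧
    HasDerivAt (fun s => p s i) (-partialFst i H (q t, p t)) t

/-- The Lie algebra of functions generated by `A`: the smallest linear space of functions that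
contains `A` and is closed under the Poisson bracket. -/
def poissonAlgebra (A : Set ((ι → ℝ) × (ι → ℝ) → ℝ)) :
    Submodule ℝ ((ι → ℝ) × (ι → ℝ) → ℝ) :=
  sInf {V | A ⊆ V ∧ ∀ f ∈ V, ∀ g ∈ V, poissonBracket f g ∈ V}

/-- `F_s`, the span of the differentials at `s` of the functions in `F`. -/
def differentials (F : Submodule ℝ ((ι → ℝ) × (ι → ℝ) → ℝ)) (s : (ι → ℝ) × (ι → ℝ)) :
    Submodule ℝ ((ι → ℝ) × (ι → ℝ) →L[ℝ] ℝ) :=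
  Submodule.span ℝ ((fun f => fderiv ℝ f s) '' (F : Set ((ι → ℝ) × (ι → ℝ) → ℝ)))

/-- The kernel of the restriction of the Poisson tensor to a space `W` of covectors. -/
def poissonKernel (W : Submodule ℝ ((ι → ℝ) × (ι → ℝ) →L[ℝ] ℝ)) :
    Submodule ℝ ((ι → ℝ) × (ι → ℝ) →L[ℝ] ℝ) where
  carrier := {α | α ∈ W ∧ ∀ β ∈ W, poissonTensor α β = 0}
  add_mem' := by
    rintro a b ⟨ha, ha'⟩ ⟨hb, hb'⟩
    refine ⟨W.add_mem ha hb, fun β hβ => ?_⟩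
    have h : poissonTensor (a + b) β = poissonTensor a β + poissonTensor b β := by
      simp only [poissonTensor, add_apply, ← Finset.sum_add_distrib]
      exact Finset.sum_congr rfl fun i _ => by ring
    rw [h, ha' β hβ, hb' β hβ, add_zero]
  zero_mem' := ⟨W.zero_mem, fun β _ => by simp [poissonTensor]⟩
  smul_mem' := by
    rintro c a ⟨ha, ha'⟩
    refine ⟨W.smul_mem c ha, fun β hβ => ?_⟩
    have h : poissonTensor (c • a) β = c * poissonTensor a β := by
      simp only [poissonTensor, smul_apply, smul_eq_mul, Finset.mul_sum]
      exact Finset.sum_congr rfl fun i _ => by ring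
    rw [h, ha' β hβ, mul_zero]

/-- `F` is a complete algebra of functions: on an open dense set the dimension of `F_s` (the
differential dimension) and that of `ker Λ|F_s` (the differential index) are constant, and they add
up to the dimension of the phase space. -/
def IsCompleteAlgebra (F : Submodule ℝ ((ι → ℝ) × (ι → ℝ) → ℝ)) : Prop :=
  ∃ (ddim dind : ℕ) (U : Set ((ι → ℝ) × (ι → ℝ))), IsOpen U ∧ Dense U ∧
    (∀ s ∈ U, Module.finrank ℝ (differentials F s) = ddim ∧
      Module.finrank ℝ (poissonKernel (differentials F s)) = dind) ∧
    ddim + dind = Module.finrank ℝ ((ι → ℝ) × (ι → ℝ))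

/-- The Hamiltonian system of `H` is completely integrable (in the non-commutative sense) by means
of `F`: `F` is a Lie algebra of smooth first integrals, and it is complete. -/
structure IsIntegrableBy (H : (ι → ℝ) × (ι → ℝ) → ℝ)
    (F : Submodule ℝ ((ι → ℝ) × (ι → ℝ) → ℝ)) : Prop where
  smooth : ∀ f ∈ F, ContDiff ℝ ∞ f
  bracket_mem : ∀ f ∈ F, ∀ g ∈ F, poissonBracket f g ∈ F
  first_integral : ∀ f ∈ F, poissonBracket f H = 0
  complete : IsCompleteAlgebra F

/-! ### Sub-Riemannian structures on `ℝ^ι`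

A distribution is `D : (ι → ℝ) → Submodule ℝ (ι → ℝ)`; a Riemannian metric is given by its matrix
`g q` in the standard coordinates. -/

/-- `β : T_q^* → T_q` is the map of the sub-Riemannian structure `(D, g)` at `q`: its image is `D`,
and `λ(v) = ⟨β λ, v⟩` for all `v ∈ D`. -/
def IsCometricMap (D : Submodule ℝ (ι → ℝ)) (g : Matrix ι ι ℝ)
    (β : (ι → ℝ) →ₗ[ℝ] (ι → ℝ)) : Prop :=
  LinearMap.range β = D ∧ ∀ p : ι → ℝ, ∀ v ∈ D, p ⬝ᵥ v = β p ⬝ᵥ g *ᵥ v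

/-- `H(q, λ) = ½ λ(β_q λ)`, where `β` is the cometric map of the sub-Riemannian structure obtained
by restricting the Riemannian metric `g` to the distribution `D`. -/
def IsSubRiemannianHamiltonian (D : (ι → ℝ) → Submodule ℝ (ι → ℝ)) (g : (ι → ℝ) → Matrix ι ι ℝ)
    (H : (ι → ℝ) × (ι → ℝ) → ℝ) : Prop :=
  ∃ β : (ι → ℝ) → (ι → ℝ) →ₗ[ℝ] (ι → ℝ), (∀ q, IsCometricMap (D q) (g q) (β q)) ∧
    ∀ q p, H (q, p) = 1 / 2 * (p ⬝ᵥ β q p)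

/-- The energy Lagrangian `½ g_q(v, v)` with a multiplier `μ` for the constraint `θ_q(v) = 0`. -/
def constrainedLagrangian (g : (ι → ℝ) → Matrix ι ι ℝ) (θ : (ι → ℝ) → ι → ℝ) (μ : ℝ)
    (s : (ι → ℝ) × (ι → ℝ)) : ℝ :=
  1 / 2 * (s.2 ⬝ᵥ g s.1 *ᵥ s.2) + μ * (θ s.1 ⬝ᵥ s.2)

/-- A normal geodesic (defined on `T`) of the metric `g` on the corank-one distribution `D`
annihilated by the 1-form `θ`: a horizontal curve that satisfies the Euler-Lagrange equations
`d/dt (∂L/∂v_i) = ∂L/∂q_i` of the energy with a Lagrange multiplier `μ(t)` for the constraint. -/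
def IsNormalGeodesic (D : (ι → ℝ) → Submodule ℝ (ι → ℝ)) (g : (ι → ℝ) → Matrix ι ι ℝ)
    (θ : (ι → ℝ) → ι → ℝ) (T : Set ℝ) (γ : ℝ → ι → ℝ) : Prop :=
  (∀ t ∈ T, DifferentiableAt ℝ γ t ∧ deriv γ t ∈ D (γ t)) ∧
  ∃ μ : ℝ → ℝ, ∀ t ∈ T, ∀ i,
    HasDerivAt
      (fun s => partialSnd i (constrainedLagrangian g θ (μ s)) (γ s, deriv γ s))
      (partialFst i (constrainedLagrangian g θ (μ t)) (γ t, deriv γ t)) t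

end Mechanics

/-! ### The Heisenberg group `H_{2n+1}` -/

/-- The coordinates of `H_{2n+1}`: `x_1, …, x_n, y_1, …, y_n, z`. -/
abbrev Coord (n : ℕ) : Type := (Fin n ⊕ Fin n) ⊕ Unit

variable {n : ℕ}

/-- The index of the coordinate `x_k` (and of `λ_k` on the cotangent space). -/
abbrev ix (k : Fin n) : Coord n := Sum.inl (Sum.inl k)

/-- The index of the coordinate `y_k` (and of `λ_{n+k}`). -/
abbrev iy (k : Fin n) : Coord n := Sum.inl (Sum.inr k)

/-- The index of the coordinate `z` (and of `λ_{2n+1}`). -/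
abbrev iz : Coord n := Sum.inr ()

/-- The underlying manifold of `H_{2n+1}`. -/
abbrev Point (n : ℕ) : Type := Coord n → ℝ

/-- The cotangent bundle of `H_{2n+1}`. -/
abbrev Phase (n : ℕ) : Type := Point n × Point n

/-- The matrix with rows `(1, xᵀ, z)`, `(0, 1, y)`, `(0, 0, 1)`. -/
def toMatrix (a : Point n) : Matrix ((Unit ⊕ Fin n) ⊕ Unit) ((Unit ⊕ Fin n) ⊕ Unit) ℝ :=
  Matrix.fromBlocks
    (Matrix.fromBlocks 1 (Matrix.replicateRow Unit fun k => a (ix k)) 0 1)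
    (Matrix.replicateCol Unit (Sum.elim (fun _ => a iz) (fun k => a (iy k)))) 0 1

/-- The group law of `H_{2n+1}`; the identity is `0`. -/
def groupMul (a b : Point n) : Point n :=
  Sum.elim (fun i => a (Sum.inl i) + b (Sum.inl i))
    (fun _ => a iz + b iz + ∑ k, a (ix k) * b (iy k))

theorem toMatrix_mul (a b : Point n) : toMatrix (groupMul a b) = toMatrix a * toMatrix b := by
  ext i j
  rcases i with (i | i) | i <;> rcases j with (j | j) | j <;>
    simp [toMatrix, groupMul, Matrix.mul_apply, Matrix.one_apply]
  all_goals ring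

/-- The differential at the identity of the right translation `h ↦ h q`. -/
def rightPush (q : Point n) : Point n →L[ℝ] Point n := fderiv ℝ (fun h => groupMul h q) 0

/-- The differential at the identity of the left translation `h ↦ q h`. -/
def leftPush (q : Point n) : Point n →L[ℝ] Point n := fderiv ℝ (fun h => groupMul q h) 0

/-- The span of `∂/∂x_k`, `∂/∂y_k` at the identity. -/
def horizontalZero (n : ℕ) : Submodule ℝ (Point n) :=
  Submodule.span ℝ (Set.range fun i : Fin n ⊕ Fin n => (Pi.single (Sum.inl i) 1 : Point n))

/-- The right-invariant distribution `D_R`. -/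
def rightDistribution (q : Point n) : Submodule ℝ (Point n) :=
  (horizontalZero n).map (rightPush q : Point n →ₗ[ℝ] Point n)

/-- The 1-form `dz - ∑ k, y_k dx_k`, which annihilates `D_R`. -/
def rightForm (q : Point n) : Point n :=
  Sum.elim (Sum.elim (fun k => -q (iy k)) (fun _ => 0)) (fun _ => 1)

/-- The matrix, in the coordinates `(x, y, z)`, of the left-invariant Riemannian metric that is
`diag(D(σ), D(σ), τ)` in the left-invariant frame. -/
def leftMetric (σ : Fin n → ℝ) (τ : ℝ) (q : Point n) : Matrix (Coord n) (Coord n) ℝ :=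
  Matrix.fromBlocks
    (Matrix.fromBlocks (Matrix.diagonal σ) 0 0
      (τ • Matrix.vecMulVec (fun k => q (ix k)) (fun k => q (ix k)) + Matrix.diagonal σ))
    (Matrix.replicateCol Unit (Sum.elim 0 fun k => -τ * q (ix k)))
    (Matrix.replicateRow Unit (Sum.elim 0 fun k => -τ * q (ix k)))
    (Matrix.of fun _ _ => τ)

theorem rightPush_apply (q v : Point n) :
    rightPush q v = Sum.elim (fun i => v (Sum.inl i)) (fun _ => v iz + ∑ k, v (ix k) * q (iy k)) := by
  have h : HasFDerivAt (fun h : Point n => groupMul h q)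
      (ContinuousLinearMap.pi fun i : Coord n => Sum.elim
        (fun j => ContinuousLinearMap.proj (R := ℝ) (φ := fun _ : Coord n => ℝ) (Sum.inl j))
        (fun _ => ContinuousLinearMap.proj (R := ℝ) (φ := fun _ : Coord n => ℝ) iz +
          ∑ k, q (iy k) • ContinuousLinearMap.proj (R := ℝ) (φ := fun _ : Coord n => ℝ) (ix k)) i)
      0 := by
    rw [hasFDerivAt_pi]
    rintro (j | j)
    · simpa [groupMul] using (hasFDerivAt_apply (𝕜 := ℝ) (Sum.inl j : Coord n) (0 : Point n)).add_const (q (Sum.inl j))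
    · refine ((hasFDerivAt_apply (𝕜 := ℝ) (iz : Coord n) (0 : Point n)).add_const _).add ?_
      exact HasFDerivAt.fun_sum fun k _ =>
        (hasFDerivAt_apply (𝕜 := ℝ) (ix k : Coord n) (0 : Point n)).mul_const _
  rw [rightPush, h.fderiv]
  ext i
  rcases i with i | i <;> simp [mul_comm]

theorem leftPush_apply (q v : Point n) :
    leftPush q v = Sum.elim (fun i => v (Sum.inl i)) (fun _ => v iz + ∑ k, q (ix k) * v (iy k)) := by
  have h : HasFDerivAt (fun h : Point n => groupMul q h)
      (ContinuousLinearMap.pi fun i : Coord n => Sum.elim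
        (fun j => ContinuousLinearMap.proj (R := ℝ) (φ := fun _ : Coord n => ℝ) (Sum.inl j))
        (fun _ => ContinuousLinearMap.proj (R := ℝ) (φ := fun _ : Coord n => ℝ) iz +
          ∑ k, q (ix k) • ContinuousLinearMap.proj (R := ℝ) (φ := fun _ : Coord n => ℝ) (iy k)) i)
      0 := by
    rw [hasFDerivAt_pi]
    rintro (j | j)
    · simpa [groupMul] using (hasFDerivAt_apply (𝕜 := ℝ) (Sum.inl j : Coord n) (0 : Point n)).const_add (q (Sum.inl j))
    · refine ((hasFDerivAt_apply (𝕜 := ℝ) (iz : Coord n) (0 : Point n)).const_add _).add ?_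
      exact HasFDerivAt.fun_sum fun k _ =>
        (hasFDerivAt_apply (𝕜 := ℝ) (iy k : Coord n) (0 : Point n)).const_mul _
  rw [leftPush, h.fderiv]
  ext i
  rcases i with i | i <;> simp

/-- `D_R` is the kernel of `rightForm`. -/
theorem mem_rightDistribution (q v : Point n) :
    v ∈ rightDistribution q ↔ rightForm q ⬝ᵥ v = 0 := by
  have hform : rightForm q ⬝ᵥ v = v iz - ∑ k, v (ix k) * q (iy k) := by
    simp [rightForm, dotProduct, Finset.sum_neg_distrib, mul_comm]
    ring
  have h0 : ∀ w : Point n, w ∈ horizontalZero n ↔ w iz = 0 := by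
    intro w
    constructor
    · intro hw
      have hle : horizontalZero n ≤
          LinearMap.ker (LinearMap.proj (R := ℝ) (φ := fun _ : Coord n => ℝ) iz) := by
        refine Submodule.span_le.2 ?_
        rintro _ ⟨i, rfl⟩
        simp
      simpa using hle hw
    · intro hw
      have : w = ∑ i : Fin n ⊕ Fin n, w (Sum.inl i) • (Pi.single (Sum.inl i) 1 : Point n) := by
        ext j
        rcases j with j | j
        · simp [Finset.sum_apply, Pi.single_apply]
        · simpa [Finset.sum_apply, Pi.single_apply] using hw
      rw [this]
      exact Submodule.sum_mem _ fun i _ =>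
        Submodule.smul_mem _ _ (Submodule.subset_span ⟨i, rfl⟩)
  rw [hform, rightDistribution, Submodule.mem_map]
  constructor
  · rintro ⟨w, hw, rfl⟩
    have := (h0 w).1 hw
    simp [rightPush_apply, this]
  · intro hv
    refine ⟨Sum.elim (fun i => v (Sum.inl i)) (fun _ => 0), (h0 _).2 rfl, ?_⟩
    ext j
    rcases j with j | j
    · simp [rightPush_apply]
    · simp [rightPush_apply]
      linarith

/-- The metric is left-invariant, with the matrix `diag(D(σ), D(σ), τ)` at the identity. -/
theorem leftMetric_leftPush (σ : Fin n → ℝ) (τ : ℝ) (q v w : Point n) :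
    leftPush q v ⬝ᵥ leftMetric σ τ q *ᵥ leftPush q w =
      ∑ k, σ k * v (ix k) * w (ix k) + ∑ k, σ k * v (iy k) * w (iy k) + τ * v iz * w iz := by
  simp only [leftPush_apply, leftMetric]
  simp [dotProduct, Matrix.mulVec, Matrix.vecMulVec_apply, Matrix.add_apply, Matrix.diagonal_apply]
  have h1 : ∀ x : Fin n, ∑ a, (τ * (q (ix x) * q (ix a)) + if x = a then σ x else 0) * w (iy a) =
      τ * q (ix x) * (∑ k, q (ix k) * w (iy k)) + σ x * w (iy x) := by
    intro x
    simp only [add_mul, Finset.sum_add_distrib, ite_mul, zero_mul, Finset.sum_ite_eq,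
      Finset.mem_univ, if_true, Finset.mul_sum]
    congr 1
    exact Finset.sum_congr rfl fun k _ => by ring
  have h2 : ∑ x, τ * q (ix x) * w (iy x) = τ * ∑ k, q (ix k) * w (iy k) := by
    rw [Finset.mul_sum]
    exact Finset.sum_congr rfl fun k _ => by ring
  have h3 : ∑ x, v (iy x) * (τ * q (ix x) * (∑ k, q (ix k) * w (iy k)) + σ x * w (iy x) +
        -(τ * q (ix x) * (w iz + ∑ k, q (ix k) * w (iy k)))) =
      ∑ k, σ k * v (iy k) * w (iy k) - τ * w iz * ∑ k, q (ix k) * v (iy k) := by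
    rw [Finset.mul_sum, ← Finset.sum_sub_distrib]
    exact Finset.sum_congr rfl fun k _ => by ring
  have h4 : ∑ x, v (ix x) * (σ x * w (ix x)) = ∑ k, σ k * v (ix k) * w (ix k) :=
    Finset.sum_congr rfl fun k _ => by ring
  simp only [h1, h2, h3, h4]
  ring

/-- The Hamiltonian
`½(λ̄ᵀ(E - τ/(1+τ⟨q,q⟩) (Jq)(Jq)ᵀ)λ̄ + 2λ_{2n+1} λ̄ᵀ(u + τ⟨u,u⟩/(1+τ⟨q,q⟩) Jq)
  + λ_{2n+1}²(⟨u,u⟩ - τ⟨u,u⟩²/(1+τ⟨q,q⟩)))`, where `q = (x, y)` and `u = (y, 0)`. -/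
def hamiltonian (τ : ℝ) (s : Phase n) : ℝ :=
  let q : Fin n ⊕ Fin n → ℝ := fun i => s.1 (Sum.inl i)
  let u : Fin n ⊕ Fin n → ℝ := Sum.elim (fun k => s.1 (iy k)) (fun _ => 0)
  let l : Fin n ⊕ Fin n → ℝ := fun i => s.2 (Sum.inl i)
  let Jq : Fin n ⊕ Fin n → ℝ := Matrix.J (Fin n) ℝ *ᵥ q
  1 / 2 *
    (l ⬝ᵥ (1 - (τ / (1 + τ * (q ⬝ᵥ q))) • Matrix.vecMulVec Jq Jq) *ᵥ l
      + 2 * s.2 iz * (l ⬝ᵥ (u + (τ * (u ⬝ᵥ u) / (1 + τ * (q ⬝ᵥ q))) • Jq))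
      + s.2 iz ^ 2 * (u ⬝ᵥ u - τ * (u ⬝ᵥ u) ^ 2 / (1 + τ * (q ⬝ᵥ q))))

/-- `x_j λ_{n+j} - y_j λ_j + ½(x_j² - y_j²) λ_{2n+1}`. -/
def angularIntegral (j : Fin n) (s : Phase n) : ℝ :=
  s.1 (ix j) * s.2 (iy j) - s.1 (iy j) * s.2 (ix j)
    + 1 / 2 * (s.1 (ix j) ^ 2 - s.1 (iy j) ^ 2) * s.2 iz

/-- `(y_b λ_a - x_a λ_{n+b} + x_b λ_{n+a} - y_a λ_b)² +
(x_a λ_b - x_b λ_a - y_a λ_{n+b} + y_b λ_{n+a} + (x_a y_b - x_b y_a) λ_{2n+1})²`. -/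
def pairIntegral (a b : Fin n) (s : Phase n) : ℝ :=
  (s.1 (iy b) * s.2 (ix a) - s.1 (ix a) * s.2 (iy b)
      + s.1 (ix b) * s.2 (iy a) - s.1 (iy a) * s.2 (ix b)) ^ 2
    + (s.1 (ix a) * s.2 (ix b) - s.1 (ix b) * s.2 (ix a)
      - s.1 (iy a) * s.2 (iy b) + s.1 (iy b) * s.2 (iy a)
      + (s.1 (ix a) * s.1 (iy b) - s.1 (ix b) * s.1 (iy a)) * s.2 iz) ^ 2

/-- The labels of the first integrals. Since `Fin n` counts from `0`, the `n - 1` labels `pair k`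
run over the coordinates other than the first one, and the `n - 2` labels `bracket k` over those
other than the first two. -/
inductive IntegralIndex (n : ℕ) : Type
  | energy : IntegralIndex n
  | angular (j : Fin n) : IntegralIndex n
  | pair (k : Fin n) (hk : 0 < k.val) : IntegralIndex n
  | center : IntegralIndex n
  | bracket (k : Fin n) (hk : 1 < k.val) : IntegralIndex n

/-- The first integrals: `H`, the `n` angular ones, the `n - 1` functions of the pairs `(1, k)`,
`λ_{2n+1}`, and the `n - 2` brackets of the function of `(1, 2)` with those of `(1, k)`, `k > 2`. -/
def firstIntegral (τ : ℝ) : IntegralIndex n → Phase n → ℝ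
  | .energy => hamiltonian τ
  | .angular j => angularIntegral j
  | .pair k hk => pairIntegral ⟨0, by omega⟩ k
  | .center => fun s => s.2 iz
  | .bracket k hk =>
      poissonBracket (pairIntegral ⟨0, by omega⟩ ⟨1, by omega⟩) (pairIntegral ⟨0, by omega⟩ k)

end Heis

end

open scoped Matrix ContDiff

noncomputable section

/-! ### Zero sets of real analytic functions -/

/-! Write z = x + iy in ℂⁿ and let P in ℂⁿ be the horizontal momentum, with components P_k = `momX
k` + i λ_{n+k}. Four real functions are built from the Hermitian products of z and P: T = |P|²/2
(`kinetic`), R = |z|² (`sqRadius`), and the two parts D, K of the product of z with P (`dilation`,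
`rotation`). The Hamiltonian is T - τK²/(2(1 + τR)) (`hamiltonian_eq`), so whatever commutes with T,
K and R commutes with it.

The flows of T, K, R and D act on each pair (z_k, P_k) by one complex 2×2 matrix, the same for all k
and with imaginary trace. They therefore change each component z_a P_b - z_b P_a of the bivector z ∧
P only by a phase, and the pair integrals, which are the squared moduli of these components, are
conserved. The angular integral I_j generates the rotation of z_j and P_j by a common phase; this
fixes T, K, R, D and all the moduli. The remaining integrals are brackets of conserved functions,
and the Jacobi identity covers them.

Completeness needs no description of the generated algebra F. Besides H, λ_{2n+1} and the angular
integrals, the function `casimir` = 2RT - D² - K² = |z ∧ P|² commutes with every generator, being a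
function of T, K, R, D. These n + 3 functions (n + 2 if n = 1, where the Casimir function is zero)
are in involution. Since a centralizer is closed under the bracket, all of F commutes with them.
Hence F_s lies in the skew-orthogonal complement of the isotropic space N spanned by their
differentials. The listed integrals are 3n - 1 in number (3 if n = 1), which is the dimension of
that complement, so at points where both families are independent F_s is the complement of N and the
kernel of the Poisson tensor on F_s is N (`finrank_differentials`).

Independence is an open dense and almost everywhere condition as soon as it holds at one point,
because all functions are real analytic (`ae_linearIndependent_fderiv`). The point `basePoint` is
chosen so that z ⊥ P and most differentials become single coordinate covectors.

For the geodesics, the Legendre transform of ½g + μθ identifies pairs (horizontal velocity,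
multiplier) with covectors. Under it the Euler–Lagrange equations become Hamilton's equations of H
(`sharp_hamiltonian_legendre`). -/

/-- The zero set of a real analytic function that is not identically zero is a null set. -/
theorem ae_ne_zero_of_analytic {E : Type*} [NormedAddCommGroup E] [NormedSpace ℝ E]
    [FiniteDimensional ℝ E] [MeasurableSpace E] [BorelSpace E] (μ : MeasureTheory.Measure E)
    [μ.IsAddHaarMeasure] {f : E → ℝ} (hf : ContDiff ℝ ω f) {a : E} (ha : f a ≠ 0) :
    ∀ᵐ x ∂μ, f x ≠ 0 := by
  -- On a line through `a` the restriction is a one-variable analytic function that is nonzero at `t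
  -- = 0`, so its zeros are isolated.
  have hline : ∀ v : E, ∀ᵐ t : ℝ, f (a + t • v) ≠ 0 := by
    intro v
    have hg : ContDiff ℝ ω fun t : ℝ => f (a + t • v) := by fun_prop
    rcases (contDiff_omega_iff_analyticOnNhd.1 hg).eqOn_zero_or_eventually_ne_zero_of_preconnected
      isPreconnected_univ with h | h
    · exact absurd (by simpa using h (Set.mem_univ 0)) ha
    · have := ae_restrict_le_codiscreteWithin (μ := MeasureTheory.volume) MeasurableSet.univ h
      rw [MeasureTheory.Measure.restrict_univ] at this
      exact this
  have hcont := hf.continuous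
  have hS : MeasurableSet {p : E × ℝ | f (a + p.2 • p.1) = 0} :=
    (isClosed_singleton.preimage (f := fun p : E × ℝ => f (a + p.2 • p.1))
      (by fun_prop : Continuous _)).measurableSet
  have hnull : (μ.prod MeasureTheory.volume) {p : E × ℝ | f (a + p.2 • p.1) = 0} = 0 := by
    rw [MeasureTheory.Measure.measure_prod_null hS]
    filter_upwards with v
    simpa [MeasureTheory.ae_iff] using hline v
  -- Fubini in the other order: for almost every t the slice in v is null. One such t ≠ 0 suffices,
  -- since v ↦ a + t v then carries the slice onto the zero set of f and scales the measure by a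
  -- nonzero factor.
  have hswap : ∀ᵐ t : ℝ, μ {v : E | f (a + t • v) = 0} = 0 := by
    have h2 : ∀ᵐ p ∂(MeasureTheory.volume : MeasureTheory.Measure ℝ).prod μ,
        f (a + p.1 • p.2) ≠ 0 := by
      rw [← MeasureTheory.Measure.prod_swap]
      refine (MeasureTheory.ae_map_iff (by fun_prop) ?_).2 ?_
      · exact (isOpen_compl_singleton.preimage (f := fun p : ℝ × E => f (a + p.1 • p.2))
          (by fun_prop : Continuous _)).measurableSet
      · simpa [MeasureTheory.ae_iff] using hnull
    filter_upwards [MeasureTheory.Measure.ae_ae_of_ae_prod h2] with t ht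
    simpa [MeasureTheory.ae_iff] using ht
  obtain ⟨t, ht, ht0⟩ : ∃ t : ℝ, μ {v : E | f (a + t • v) = 0} = 0 ∧ t ≠ 0 :=
    (hswap.and (MeasureTheory.Measure.ae_ne MeasureTheory.volume 0)).exists
  have hpre : {v : E | f (a + t • v) = 0} = (t • ·) ⁻¹' ((a + ·) ⁻¹' {x | f x = 0}) := rfl
  rw [hpre, MeasureTheory.Measure.addHaar_preimage_smul μ ht0, MeasureTheory.measure_preimage_add]
    at ht
  have hpos : ENNReal.ofReal |(t ^ Module.finrank ℝ E)⁻¹| ≠ 0 := by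
    simpa using pow_pos (abs_pos.2 ht0) _
  simpa only [MeasureTheory.ae_iff, not_not] using (mul_eq_zero.1 ht).resolve_left hpos

/-- A finite family of vectors of a dual space is linearly independent if the matrix of its values
on some family of vectors is invertible. -/
theorem linearIndependent_of_det_ne_zero {E ι : Type*} [NormedAddCommGroup E] [NormedSpace ℝ E]
    [Fintype ι] [DecidableEq ι] (α : ι → E →L[ℝ] ℝ) (e : ι → E)
    (h : (Matrix.of fun i j => α i (e j)).det ≠ 0) : LinearIndependent ℝ α := by
  rw [Fintype.linearIndependent_iff]
  intro w hw i
  have : w ᵥ* (Matrix.of fun i j => α i (e j)) = 0 := by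
    ext j
    simpa [Matrix.vecMul, dotProduct] using congrArg (fun β : E →L[ℝ] ℝ => β (e j)) hw
  exact congrFun (Matrix.eq_zero_of_vecMul_eq_zero h this) i

/-- A matrix is invertible if its columns outside `S` and its square block on `S` are diagonal, with
nonzero diagonal entries. -/
theorem det_ne_zero_of_diagonal_off {ι : Type*} [Fintype ι] [DecidableEq ι] (M : Matrix ι ι ℝ)
    (S : Set ι) (hd : ∀ i, M i i ≠ 0) (hoff : ∀ i j, i ≠ j → j ∉ S → M i j = 0)
    (hS : ∀ i j, i ≠ j → i ∈ S → j ∈ S → M i j = 0) : M.det ≠ 0 := by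
  intro h0
  obtain ⟨w, hw, hwM⟩ := Matrix.exists_vecMul_eq_zero_iff.2 h0
  have hcol : ∀ j, (∀ i, i ≠ j → w i * M i j = 0) → w j = 0 := by
    intro j hj
    have h1 : ∑ i, w i * M i j = 0 := congrFun hwM j
    rw [Finset.sum_eq_single j (fun i _ hi => hj i hi) (by simp)] at h1
    exact (mul_eq_zero.1 h1).resolve_right (hd j)
  have hw1 : ∀ j, j ∉ S → w j = 0 := fun j hj =>
    hcol j fun i hi => by rw [hoff i j hi hj, mul_zero]
  refine hw (funext fun j => ?_)
  by_cases hj : j ∈ S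
  · refine hcol j fun i hi => ?_
    by_cases hiS : i ∈ S
    · rw [hS i j hi hiS hj, mul_zero]
    · rw [hw1 i hiS, zero_mul]
  · exact hw1 j hj

/-- A finite family of analytic functions whose differentials have an invertible matrix of values at
one point has independent differentials almost everywhere, and on an open dense set. -/
theorem ae_linearIndependent_fderiv {E ι : Type*} [NormedAddCommGroup E] [NormedSpace ℝ E]
    [FiniteDimensional ℝ E] [MeasurableSpace E] [BorelSpace E] (μ : MeasureTheory.Measure E)
    [μ.IsAddHaarMeasure] [Fintype ι] [DecidableEq ι] {f : ι → E → ℝ}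
    (hf : ∀ i, ContDiff ℝ ω (f i)) (a : E) (e : ι → E)
    (h : (Matrix.of fun i j => fderiv ℝ (f i) a (e j)).det ≠ 0) :
    (∀ᵐ s ∂μ, LinearIndependent ℝ fun i => fderiv ℝ (f i) s) ∧
      ∃ U : Set E, IsOpen U ∧ Dense U ∧
        ∀ s ∈ U, LinearIndependent ℝ fun i => fderiv ℝ (f i) s := by
  set d : E → ℝ := fun s => (Matrix.of fun i j => fderiv ℝ (f i) s (e j)).det with hd
  have hdc : ContDiff ℝ ω d := by
    have h1 : ∀ i j, ContDiff ℝ ω fun s => fderiv ℝ (f i) s (e j) := fun i j =>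
      ((hf i).fderiv_right (m := ω) le_rfl).clm_apply contDiff_const
    simp only [hd, Matrix.det_apply', Matrix.of_apply]
    exact ContDiff.sum fun σ _ => contDiff_const.mul (contDiff_prod fun i _ => h1 _ _)
  have hae := ae_ne_zero_of_analytic μ hdc (a := a) h
  refine ⟨hae.mono fun s hs => linearIndependent_of_det_ne_zero _ e hs, {s | d s ≠ 0},
    isOpen_compl_singleton.preimage hdc.continuous, ?_,
    fun s hs => linearIndependent_of_det_ne_zero _ e hs⟩
  exact MeasureTheory.Measure.dense_of_ae hae

/-! ### Calculus of the canonical Poisson bracket -/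

theorem fderiv_fderiv_symm {E : Type*} [NormedAddCommGroup E] [NormedSpace ℝ E] {f : E → ℝ}
    (hf : ContDiff ℝ ∞ f) (s v w : E) :
    fderiv ℝ (fderiv ℝ f) s v w = fderiv ℝ (fderiv ℝ f) s w v :=
  (contDiff_infty.1 hf 2).contDiffAt.isSymmSndFDerivAt (by simp) v w

namespace Heis

section Mechanics

variable {ι : Type} [Fintype ι] [DecidableEq ι]

/-- The vector dual to a covector with respect to the canonical Poisson tensor. -/
def sharp (β : (ι → ℝ) × (ι → ℝ) →L[ℝ] ℝ) : (ι → ℝ) × (ι → ℝ) :=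
  (fun i => β (0, Pi.single i 1), fun i => -β (Pi.single i 1, 0))

theorem clm_apply_eq_sum (α : (ι → ℝ) × (ι → ℝ) →L[ℝ] ℝ) (v : (ι → ℝ) × (ι → ℝ)) :
    α v = ∑ i, (v.1 i * α (Pi.single i 1, 0) + v.2 i * α (0, Pi.single i 1)) := by
  have hv : v = ∑ i, (v.1 i • ((Pi.single i 1, 0) : (ι → ℝ) × (ι → ℝ)) +
      v.2 i • ((0, Pi.single i 1) : (ι → ℝ) × (ι → ℝ))) := by
    ext j <;> simp [Prod.fst_sum, Prod.snd_sum, Finset.sum_apply, Pi.single_apply]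
  conv_lhs => rw [hv]
  simp only [map_sum, map_add, map_smul, smul_eq_mul]

theorem poissonTensor_eq_apply_sharp (α β : (ι → ℝ) × (ι → ℝ) →L[ℝ] ℝ) :
    poissonTensor α β = α (sharp β) := by
  rw [clm_apply_eq_sum α, poissonTensor]
  exact Finset.sum_congr rfl fun i _ => by simp only [sharp]; ring

theorem poissonTensor_swap (α β : (ι → ℝ) × (ι → ℝ) →L[ℝ] ℝ) :
    poissonTensor α β = -poissonTensor β α := by
  simp only [poissonTensor, ← Finset.sum_neg_distrib]
  exact Finset.sum_congr rfl fun i _ => by ring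

/-- The canonical Poisson tensor as a bilinear form. -/
def poissonForm (ι : Type) [Fintype ι] [DecidableEq ι] :
    LinearMap.BilinForm ℝ ((ι → ℝ) × (ι → ℝ) →L[ℝ] ℝ) :=
  LinearMap.mk₂ ℝ poissonTensor
    (fun a b c => by simp only [poissonTensor_eq_apply_sharp, add_apply])
    (fun r a b => by simp only [poissonTensor_eq_apply_sharp, smul_apply])
    (fun a b c => by
      rw [poissonTensor_swap, poissonTensor_swap a b, poissonTensor_swap a c]
      simp only [poissonTensor_eq_apply_sharp, add_apply]
      ring)
    (fun r a b => by
      rw [poissonTensor_swap, poissonTensor_swap a b]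
      simp only [poissonTensor_eq_apply_sharp, smul_apply, smul_eq_mul]
      ring)

@[simp] theorem poissonForm_apply (α β : (ι → ℝ) × (ι → ℝ) →L[ℝ] ℝ) :
    poissonForm ι α β = poissonTensor α β := rfl

theorem poissonForm_isRefl : (poissonForm ι).IsRefl := by
  intro α β h
  rw [poissonForm_apply] at *
  rw [poissonTensor_swap, h, neg_zero]

theorem poissonForm_nondegenerate : (poissonForm ι).Nondegenerate := by
  have hleft : (poissonForm ι).SeparatingLeft := by
    intro α h
    have h1 : ∀ i, α (Pi.single i 1, 0) = 0 := by
      intro i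
      -- The covectors dp_i and -dq_i have `sharp` equal to the basis vectors of q_i and p_i, so
      -- pairing with them reads off all coordinates of α.
      have := h ((ContinuousLinearMap.proj i).comp (ContinuousLinearMap.snd ℝ (ι → ℝ) (ι → ℝ)))
      rw [poissonForm_apply, poissonTensor_eq_apply_sharp] at this
      rw [← this]
      congr 1
      ext j <;> simp [sharp, Pi.single_comm]
    have h2 : ∀ i, α (0, Pi.single i 1) = 0 := by
      intro i
      have := h (-(ContinuousLinearMap.proj i).comp (ContinuousLinearMap.fst ℝ (ι → ℝ) (ι → ℝ)))
      rw [poissonForm_apply, poissonTensor_eq_apply_sharp] at this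
      rw [← this]
      congr 1
      ext j <;> simp [sharp, Pi.single_comm]
    refine ContinuousLinearMap.ext fun v => ?_
    rw [clm_apply_eq_sum]
    simp [h1, h2]
  refine ⟨hleft, fun β h => hleft β fun α => ?_⟩
  rw [poissonForm_apply, poissonTensor_swap, ← poissonForm_apply, h, neg_zero]

theorem poissonBracket_eq_apply_sharp (f g : (ι → ℝ) × (ι → ℝ) → ℝ) (s : (ι → ℝ) × (ι → ℝ)) :
    poissonBracket f g s = fderiv ℝ f s (sharp (fderiv ℝ g s)) :=
  poissonTensor_eq_apply_sharp _ _

theorem poissonBracket_swap (f g : (ι → ℝ) × (ι → ℝ) → ℝ) :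
    poissonBracket f g = -poissonBracket g f :=
  funext fun _ => poissonTensor_swap _ _

theorem poissonBracket_self (f : (ι → ℝ) × (ι → ℝ) → ℝ) : poissonBracket f f = 0 := by
  have h := poissonBracket_swap f f
  funext s
  have hs := congrFun h s
  simp only [Pi.neg_apply] at hs
  simp only [Pi.zero_apply]
  linarith

theorem poissonBracket_comm_zero {f g : (ι → ℝ) × (ι → ℝ) → ℝ} (h : poissonBracket f g = 0) :
    poissonBracket g f = 0 := by
  rw [poissonBracket_swap, h, neg_zero]

/-- The condition `m + 1 ≤ m` admits ∞ and ω. Smoothness serves the Jacobi identity, and analyticity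
the passage from one point to almost all points. -/
theorem contDiff_poissonBracket {m : WithTop ℕ∞} (hm : m + 1 ≤ m)
    {f g : (ι → ℝ) × (ι → ℝ) → ℝ} (hf : ContDiff ℝ m f)
    (hg : ContDiff ℝ m g) : ContDiff ℝ m (poissonBracket f g) := by
  have h : ∀ {h : (ι → ℝ) × (ι → ℝ) → ℝ}, ContDiff ℝ m h →
      ∀ v, ContDiff ℝ m fun s => fderiv ℝ h s v :=
    fun hh v => (hh.fderiv_right hm).clm_apply contDiff_const
  unfold poissonBracket poissonTensor
  exact ContDiff.sum fun i _ => ((h hf _).mul (h hg _)).sub ((h hf _).mul (h hg _))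

/-- The bracket with `h` of a bracket `{f, g}`, through second derivatives. -/
theorem poissonBracket_poissonBracket {f g : (ι → ℝ) × (ι → ℝ) → ℝ} (hf : ContDiff ℝ ∞ f)
    (hg : ContDiff ℝ ∞ g) (h : (ι → ℝ) × (ι → ℝ) → ℝ) (s : (ι → ℝ) × (ι → ℝ)) :
    poissonBracket (poissonBracket f g) h s =
      fderiv ℝ (fderiv ℝ f) s (sharp (fderiv ℝ h s)) (sharp (fderiv ℝ g s)) -
        fderiv ℝ (fderiv ℝ g) s (sharp (fderiv ℝ h s)) (sharp (fderiv ℝ f s)) := by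
  have hd : ∀ {k : (ι → ℝ) × (ι → ℝ) → ℝ}, ContDiff ℝ ∞ k → ∀ v,
      HasFDerivAt (fun s => fderiv ℝ k s v)
        ((ContinuousLinearMap.apply ℝ ℝ v).comp (fderiv ℝ (fderiv ℝ k) s)) s := by
    intro k hk v
    have h1 : DifferentiableAt ℝ (fderiv ℝ k) s :=
      (hk.fderiv_right (m := ∞) le_rfl).differentiable (by simp) s
    exact (ContinuousLinearMap.apply ℝ ℝ v).hasFDerivAt.comp s h1.hasFDerivAt
  have hB := HasFDerivAt.fun_sum (u := Finset.univ) fun i (_ : i ∈ Finset.univ) =>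
    ((hd hf (Pi.single i 1, 0)).mul (hd hg (0, Pi.single i 1))).sub
      ((hd hf (0, Pi.single i 1)).mul (hd hg (Pi.single i 1, 0)))
  rw [poissonBracket_eq_apply_sharp, show fderiv ℝ (poissonBracket f g) s = _ from hB.fderiv]
  rw [← poissonTensor_eq_apply_sharp _ (fderiv ℝ g s),
    ← poissonTensor_eq_apply_sharp _ (fderiv ℝ f s), poissonTensor, poissonTensor, ← Finset.sum_sub_distrib]
  simp only [sum_apply, sub_apply, add_apply, smul_apply, smul_eq_mul,
    ContinuousLinearMap.comp_apply, ContinuousLinearMap.apply_apply]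
  exact Finset.sum_congr rfl fun i _ => by ring

/-- The Jacobi identity. -/
theorem poissonBracket_jacobi {f g h : (ι → ℝ) × (ι → ℝ) → ℝ} (hf : ContDiff ℝ ∞ f)
    (hg : ContDiff ℝ ∞ g) (hh : ContDiff ℝ ∞ h) (s : (ι → ℝ) × (ι → ℝ)) :
    poissonBracket (poissonBracket f g) h s + poissonBracket (poissonBracket g h) f s +
      poissonBracket (poissonBracket h f) g s = 0 := by
  -- Each of the three Hessians now occurs twice, with its arguments exchanged and opposite signs,
  -- so its symmetry cancels the sum.
  rw [poissonBracket_poissonBracket hf hg, poissonBracket_poissonBracket hg hh,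
    poissonBracket_poissonBracket hh hf, fderiv_fderiv_symm hf, fderiv_fderiv_symm hg,
    fderiv_fderiv_symm hh]
  ring

theorem poissonBracket_zero_left (g : (ι → ℝ) × (ι → ℝ) → ℝ) :
    poissonBracket (0 : (ι → ℝ) × (ι → ℝ) → ℝ) g = 0 := by
  funext s
  simp [poissonBracket_eq_apply_sharp]

theorem poissonBracket_bracket_eq_zero {f g h : (ι → ℝ) × (ι → ℝ) → ℝ} (hf : ContDiff ℝ ∞ f)
    (hg : ContDiff ℝ ∞ g) (hh : ContDiff ℝ ∞ h) (h1 : poissonBracket f h = 0)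
    (h2 : poissonBracket g h = 0) : poissonBracket (poissonBracket f g) h = 0 := by
  funext s
  have hj := poissonBracket_jacobi hf hg hh s
  rw [h2, poissonBracket_comm_zero h1, poissonBracket_zero_left, poissonBracket_zero_left] at hj
  simpa using hj

/-! ### Generated Lie algebras, centralizers and the dimension count for completeness -/

theorem subset_poissonAlgebra (A : Set ((ι → ℝ) × (ι → ℝ) → ℝ)) :
    A ⊆ poissonAlgebra A := by
  intro f hf
  simp only [poissonAlgebra, SetLike.mem_coe, Submodule.mem_sInf]
  exact fun V hV => hV.1 hf

theorem poissonBracket_mem_poissonAlgebra {A : Set ((ι → ℝ) × (ι → ℝ) → ℝ)}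
    {f g : (ι → ℝ) × (ι → ℝ) → ℝ} (hf : f ∈ poissonAlgebra A) (hg : g ∈ poissonAlgebra A) :
    poissonBracket f g ∈ poissonAlgebra A := by
  simp only [poissonAlgebra, Submodule.mem_sInf] at *
  exact fun V hV => hV.2 f (hf V hV) g (hg V hV)

/-- The smooth functions that Poisson-commute with all functions in `G`. -/
def centralizer (G : Set ((ι → ℝ) × (ι → ℝ) → ℝ)) : Submodule ℝ ((ι → ℝ) × (ι → ℝ) → ℝ) where
  carrier := {f | ContDiff ℝ ∞ f ∧ ∀ g ∈ G, poissonBracket f g = 0}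
  add_mem' := by
    rintro a b ⟨ha, ha'⟩ ⟨hb, hb'⟩
    refine ⟨ha.add hb, fun g hg => funext fun s => ?_⟩
    have h1 := congrFun (ha' g hg) s
    have h2 := congrFun (hb' g hg) s
    rw [poissonBracket_eq_apply_sharp] at *
    rw [fderiv_add (ha.differentiable (by simp) s) (hb.differentiable (by simp) s)]
    simp [h1, h2]
  zero_mem' := ⟨contDiff_const, fun g _ => poissonBracket_zero_left g⟩
  smul_mem' := by
    rintro r a ⟨ha, ha'⟩
    refine ⟨contDiff_const.smul ha, fun g hg => funext fun s => ?_⟩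
    have h1 := congrFun (ha' g hg) s
    rw [poissonBracket_eq_apply_sharp] at *
    rw [fderiv_const_smul (ha.differentiable (by simp) s)]
    simp [h1]

theorem mem_centralizer {G : Set ((ι → ℝ) × (ι → ℝ) → ℝ)} {f : (ι → ℝ) × (ι → ℝ) → ℝ} :
    f ∈ centralizer G ↔ ContDiff ℝ ∞ f ∧ ∀ g ∈ G, poissonBracket f g = 0 := Iff.rfl

/-- By the Jacobi identity the centralizer is itself a linear space closed under the bracket, so it
competes in the infimum that defines `poissonAlgebra A`. This controls all iterated brackets without
computing any. -/
theorem poissonAlgebra_le_centralizer {A G : Set ((ι → ℝ) × (ι → ℝ) → ℝ)}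
    (hG : ∀ g ∈ G, ContDiff ℝ ∞ g) (hA : A ⊆ centralizer G) :
    poissonAlgebra A ≤ centralizer G := by
  refine sInf_le ⟨hA, ?_⟩
  rintro f ⟨hf, hf'⟩ g ⟨hg, hg'⟩
  exact ⟨contDiff_poissonBracket le_rfl hf hg, fun h hh =>
    poissonBracket_bracket_eq_zero hf hg (hG h hh) (hf' h hh) (hg' h hh)⟩

theorem mem_orthogonal_span {κ : Type*} {β : κ → (ι → ℝ) × (ι → ℝ) →L[ℝ] ℝ}
    {α : (ι → ℝ) × (ι → ℝ) →L[ℝ] ℝ} (h : ∀ j, poissonTensor (β j) α = 0) :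
    α ∈ (poissonForm ι).orthogonal (Submodule.span ℝ (Set.range β)) := by
  have hle : Submodule.span ℝ (Set.range β) ≤ LinearMap.ker ((poissonForm ι).flip α) := by
    refine Submodule.span_le.2 ?_
    rintro _ ⟨j, rfl⟩
    exact h j
  exact LinearMap.BilinForm.mem_orthogonal_iff.2 fun γ hγ => hle hγ

/-- If the algebra contains `κ`-many independent functions, commutes with `κ'`-many independent
functions in involution, and `#κ + #κ' = dim`, then at such a point the covectors of the algebra
have dimension `#κ`, and the kernel of the Poisson tensor on them has dimension `#κ'`. -/
theorem finrank_differentials {κ κ' : Type*} [Fintype κ] [Fintype κ']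
    {F : Submodule ℝ ((ι → ℝ) × (ι → ℝ) → ℝ)} {f : κ → (ι → ℝ) × (ι → ℝ) → ℝ}
    {g : κ' → (ι → ℝ) × (ι → ℝ) → ℝ} {s : (ι → ℝ) × (ι → ℝ)}
    (hf : ∀ i, f i ∈ F) (hfg : ∀ h ∈ F, ∀ j, poissonBracket h (g j) s = 0)
    (hgg : ∀ i j, poissonBracket (g i) (g j) s = 0)
    (hfi : LinearIndependent ℝ fun i => fderiv ℝ (f i) s)
    (hgi : LinearIndependent ℝ fun i => fderiv ℝ (g i) s)
    (hcard : Fintype.card κ + Fintype.card κ' = Module.finrank ℝ ((ι → ℝ) × (ι → ℝ))) :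
    Module.finrank ℝ (differentials F s) = Fintype.card κ ∧
      Module.finrank ℝ (poissonKernel (differentials F s)) = Fintype.card κ' := by
  set N := Submodule.span ℝ (Set.range fun i => fderiv ℝ (g i) s) with hN
  have hdim : Module.finrank ℝ ((ι → ℝ) × (ι → ℝ) →L[ℝ] ℝ) =
      Module.finrank ℝ ((ι → ℝ) × (ι → ℝ)) := by
    rw [← (LinearMap.toContinuousLinearMap (𝕜 := ℝ) (E := (ι → ℝ) × (ι → ℝ))
      (F' := ℝ)).finrank_eq]
    exact Subspace.dual_finrank_eq
  have hNdim : Module.finrank ℝ N = Fintype.card κ' := finrank_span_eq_card hgi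
  have hodim : Module.finrank ℝ ((poissonForm ι).orthogonal N) = Fintype.card κ := by
    rw [LinearMap.BilinForm.finrank_orthogonal poissonForm_nondegenerate, hNdim, hdim]
    omega
  have hle : differentials F s ≤ (poissonForm ι).orthogonal N := by
    refine Submodule.span_le.2 ?_
    rintro _ ⟨h, hh, rfl⟩
    exact mem_orthogonal_span fun j => poissonForm_isRefl _ _ (hfg h hh j)
  have hge : Submodule.span ℝ (Set.range fun i => fderiv ℝ (f i) s) ≤ differentials F s := by
    refine Submodule.span_le.2 ?_
    rintro _ ⟨i, rfl⟩
    exact Submodule.subset_span ⟨f i, hf i, rfl⟩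
  -- The inclusion is squeezed by dimension: F_s contains `#κ` independent covectors, and the
  -- complement of N has exactly that dimension.
  have heq : differentials F s = (poissonForm ι).orthogonal N := by
    refine Submodule.eq_of_le_of_finrank_le hle ?_
    rw [hodim, ← finrank_span_eq_card hfi]
    exact Submodule.finrank_mono hge
  have hNle : N ≤ (poissonForm ι).orthogonal N := by
    rw [hN, Submodule.span_le]
    rintro _ ⟨i, rfl⟩
    exact mem_orthogonal_span fun j => hgg j i
  -- The kernel is the intersection of N^⊥ with N^⊥⊥ = N, and N is isotropic, that is, contained in
  -- N^⊥.
  have hker : poissonKernel (differentials F s) = N := by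
    rw [heq]
    have hoo := LinearMap.BilinForm.orthogonal_orthogonal poissonForm_nondegenerate
      (poissonForm_isRefl (ι := ι)) N
    ext α
    constructor
    · rintro ⟨_, hα⟩
      rw [← hoo]
      exact LinearMap.BilinForm.mem_orthogonal_iff.2 fun β hβ =>
        poissonForm_isRefl _ _ (hα β hβ)
    · intro hα
      refine ⟨hNle hα, fun β hβ => ?_⟩
      exact LinearMap.BilinForm.mem_orthogonal_iff.1 hβ α hα
  rw [hker, heq]
  exact ⟨hodim, hNdim⟩

end Mechanics

variable {n : ℕ}

/-! ### The invariants of the unitary group -/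

/-- The momentum `λ_k + y_k λ_{2n+1}` of the right-invariant field `∂/∂x_k + y_k ∂/∂z`. -/
def momX (k : Fin n) (s : Phase n) : ℝ := s.2 (ix k) + s.1 (iy k) * s.2 iz

/-- The differential of `momX k` at `s` in the direction `v`. -/
def dmomX (k : Fin n) (s v : Phase n) : ℝ :=
  v.2 (ix k) + (v.1 (iy k) * s.2 iz + s.1 (iy k) * v.2 iz)

/-- Half the squared length of the right-invariant horizontal momentum. -/
def kinetic (s : Phase n) : ℝ := 1 / 2 * ∑ k, (momX k s ^ 2 + s.2 (iy k) ^ 2)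

/-- The pairing of the horizontal momentum with `J q`. -/
def rotation (s : Phase n) : ℝ := ∑ k, (s.1 (ix k) * s.2 (iy k) - s.1 (iy k) * momX k s)

/-- The squared length of `q = (x, y)`. -/
def sqRadius (s : Phase n) : ℝ := ∑ k, (s.1 (ix k) ^ 2 + s.1 (iy k) ^ 2)

/-- The pairing of the horizontal momentum with `q`. -/
def dilation (s : Phase n) : ℝ := ∑ k, (s.1 (ix k) * momX k s + s.1 (iy k) * s.2 (iy k))

/-- The squared length of the bivector `z ∧ P`, where `z = x + iy` and `P` is the complex horizontal
momentum. -/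
def casimir (s : Phase n) : ℝ :=
  2 * sqRadius s * kinetic s - dilation s ^ 2 - rotation s ^ 2

/-- The imaginary part, up to sign, of `z_a P_b - z_b P_a`. -/
def pairIm (a b : Fin n) (s : Phase n) : ℝ :=
  s.1 (iy b) * s.2 (ix a) - s.1 (ix a) * s.2 (iy b)
      + s.1 (ix b) * s.2 (iy a) - s.1 (iy a) * s.2 (ix b)

/-- The real part of `z_a P_b - z_b P_a`. -/
def pairRe (a b : Fin n) (s : Phase n) : ℝ :=
  s.1 (ix a) * s.2 (ix b) - s.1 (ix b) * s.2 (ix a)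
      - s.1 (iy a) * s.2 (iy b) + s.1 (iy b) * s.2 (iy a)
      + (s.1 (ix a) * s.1 (iy b) - s.1 (ix b) * s.1 (iy a)) * s.2 iz

/-- The terms in λ_{2n+1} complete the squares: P = λ̄ + λ_{2n+1} u, and ⟨u, Jq⟩ = -⟨u, u⟩ gives ⟨P,
Jq⟩ = ⟨λ̄, Jq⟩ - λ_{2n+1}⟨u, u⟩. -/
theorem hamiltonian_eq (τ : ℝ) :
    hamiltonian (n := n) τ =
      fun s => kinetic s - 1 / 2 * (τ / (1 + τ * sqRadius s) * rotation s ^ 2) := by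
  funext s
  have hJ : Matrix.J (Fin n) ℝ *ᵥ (fun i => s.1 (Sum.inl i)) =
      Sum.elim (fun k => -s.1 (iy k)) fun k => s.1 (ix k) := by
    funext i
    rcases i with i | i <;>
      simp [Matrix.J, Matrix.mulVec, dotProduct, Matrix.one_apply]
  have hq : ((fun i => s.1 (Sum.inl i)) ⬝ᵥ fun i : Fin n ⊕ Fin n => s.1 (Sum.inl i)) =
      sqRadius s := by
    simp only [sqRadius, dotProduct, Fintype.sum_sum_type, ← Finset.sum_add_distrib, sq]
  set U : ℝ := ∑ k, s.1 (iy k) ^ 2 with hU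
  set A : ℝ := ∑ k, (s.1 (ix k) * s.2 (iy k) - s.1 (iy k) * s.2 (ix k)) with hA
  have hu : (Sum.elim (fun k => s.1 (iy k)) (fun _ => 0) : Fin n ⊕ Fin n → ℝ) ⬝ᵥ
      Sum.elim (fun k => s.1 (iy k)) (fun _ => 0) = U := by
    simp [dotProduct, hU, sq]
  have hrot : rotation s = A - s.2 iz * U := by
    simp only [rotation, momX, hA, hU, Finset.mul_sum, ← Finset.sum_sub_distrib]
    exact Finset.sum_congr rfl fun k _ => by ring
  have hlJ : (fun i => s.2 (Sum.inl i)) ⬝ᵥ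
      (Sum.elim (fun k => -s.1 (iy k)) fun k => s.1 (ix k)) = A := by
    simp only [dotProduct, Fintype.sum_sum_type, Sum.elim_inl, Sum.elim_inr,
      ← Finset.sum_add_distrib, hA]
    exact Finset.sum_congr rfl fun k _ => by ring
  have hkin : kinetic s = 1 / 2 * ((fun i => s.2 (Sum.inl i)) ⬝ᵥ (fun i => s.2 (Sum.inl i)) +
      2 * s.2 iz * ((fun i => s.2 (Sum.inl i)) ⬝ᵥ
        (Sum.elim (fun k => s.1 (iy k)) (fun _ => 0) : Fin n ⊕ Fin n → ℝ)) +
      s.2 iz ^ 2 * U) := by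
    simp only [kinetic, momX, hU, dotProduct, Fintype.sum_sum_type, Sum.elim_inl, Sum.elim_inr,
      Finset.mul_sum, ← Finset.sum_add_distrib]
    exact Finset.sum_congr rfl fun k _ => by ring
  simp only [hamiltonian]
  rw [hJ, hq, hu, Matrix.sub_mulVec, Matrix.one_mulVec, Matrix.smul_mulVec,
    Matrix.vecMulVec_mulVec, dotProduct_sub, dotProduct_add, dotProduct_smul, dotProduct_smul,
    dotProduct_smul, dotProduct_comm (Sum.elim (fun k => -s.1 (iy k)) fun k => s.1 (ix k)), hlJ,
    hkin, hrot]
  simp only [smul_eq_mul, MulOpposite.smul_eq_mul_unop, MulOpposite.unop_op]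
  ring

/-! ### Differentials -/

/-- The coordinate `q_i` as a linear function on the phase space. -/
def dq (i : Coord n) : Phase n →L[ℝ] ℝ :=
  (ContinuousLinearMap.proj i).comp (ContinuousLinearMap.fst ℝ (Point n) (Point n))

/-- The coordinate `λ_i` as a linear function on the phase space. -/
def dp (i : Coord n) : Phase n →L[ℝ] ℝ :=
  (ContinuousLinearMap.proj i).comp (ContinuousLinearMap.snd ℝ (Point n) (Point n))

@[simp] theorem dq_apply (i : Coord n) (v : Phase n) : dq i v = v.1 i := rfl

@[simp] theorem dp_apply (i : Coord n) (v : Phase n) : dp i v = v.2 i := rfl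

theorem hasFDerivAt_q (i : Coord n) (s : Phase n) :
    HasFDerivAt (fun s : Phase n => s.1 i) (dq i) s := (dq i).hasFDerivAt

theorem hasFDerivAt_p (i : Coord n) (s : Phase n) :
    HasFDerivAt (fun s : Phase n => s.2 i) (dp i) s := (dp i).hasFDerivAt

theorem hasFDerivAt_momX (k : Fin n) (s : Phase n) :
    HasFDerivAt (momX k) (dp (ix k) + (s.1 (iy k) • dp iz + s.2 iz • dq (iy k))) s :=
  (hasFDerivAt_p _ s).add ((hasFDerivAt_q _ s).mul (hasFDerivAt_p _ s))

theorem contDiff_q {m : WithTop ℕ∞} (i : Coord n) : ContDiff ℝ m fun s : Phase n => s.1 i :=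
  (dq i).contDiff

theorem contDiff_p {m : WithTop ℕ∞} (i : Coord n) : ContDiff ℝ m fun s : Phase n => s.2 i :=
  (dp i).contDiff

theorem contDiff_momX {m : WithTop ℕ∞} (k : Fin n) : ContDiff ℝ m (momX k) :=
  (contDiff_p _).add ((contDiff_q _).mul (contDiff_p _))

theorem contDiff_kinetic {m : WithTop ℕ∞} : ContDiff ℝ m (kinetic (n := n)) :=
  contDiff_const.mul (ContDiff.sum fun k _ => ((contDiff_momX k).pow 2).add ((contDiff_p _).pow 2))

theorem contDiff_rotation {m : WithTop ℕ∞} : ContDiff ℝ m (rotation (n := n)) :=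
  ContDiff.sum fun k _ => ((contDiff_q _).mul (contDiff_p _)).sub
    ((contDiff_q _).mul (contDiff_momX k))

theorem contDiff_sqRadius {m : WithTop ℕ∞} : ContDiff ℝ m (sqRadius (n := n)) :=
  ContDiff.sum fun _ _ => ((contDiff_q _).pow 2).add ((contDiff_q _).pow 2)

theorem contDiff_dilation {m : WithTop ℕ∞} : ContDiff ℝ m (dilation (n := n)) :=
  ContDiff.sum fun k _ => ((contDiff_q _).mul (contDiff_momX k)).add
    ((contDiff_q _).mul (contDiff_p _))

theorem contDiff_casimir {m : WithTop ℕ∞} : ContDiff ℝ m (casimir (n := n)) :=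
  (((contDiff_const.mul contDiff_sqRadius).mul contDiff_kinetic).sub
    (contDiff_dilation.pow 2)).sub (contDiff_rotation.pow 2)

theorem contDiff_pairIm {m : WithTop ℕ∞} (a b : Fin n) : ContDiff ℝ m (pairIm a b) :=
  ((((contDiff_q _).mul (contDiff_p _)).sub ((contDiff_q _).mul (contDiff_p _))).add
    ((contDiff_q _).mul (contDiff_p _))).sub ((contDiff_q _).mul (contDiff_p _))

theorem contDiff_pairRe {m : WithTop ℕ∞} (a b : Fin n) : ContDiff ℝ m (pairRe a b) :=
  (((((contDiff_q _).mul (contDiff_p _)).sub ((contDiff_q _).mul (contDiff_p _))).sub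
    ((contDiff_q _).mul (contDiff_p _))).add ((contDiff_q _).mul (contDiff_p _))).add
    ((((contDiff_q _).mul (contDiff_q _)).sub ((contDiff_q _).mul (contDiff_q _))).mul
      (contDiff_p _))

theorem contDiff_pairIntegral {m : WithTop ℕ∞} (a b : Fin n) : ContDiff ℝ m (pairIntegral a b) :=
  ((contDiff_pairIm a b).pow 2).add ((contDiff_pairRe a b).pow 2)

theorem contDiff_angularIntegral {m : WithTop ℕ∞} (j : Fin n) :
    ContDiff ℝ m (angularIntegral j) :=
  (((contDiff_q _).mul (contDiff_p _)).sub ((contDiff_q _).mul (contDiff_p _))).add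
    ((contDiff_const.mul (((contDiff_q _).pow 2).sub ((contDiff_q _).pow 2))).mul (contDiff_p _))

theorem sqRadius_nonneg (s : Phase n) : 0 ≤ sqRadius s :=
  Finset.sum_nonneg fun _ _ => by positivity

theorem one_add_pos {τ : ℝ} (hτ : 0 < τ) (s : Phase n) : 0 < 1 + τ * sqRadius s := by
  have := mul_nonneg hτ.le (sqRadius_nonneg s)
  linarith

theorem contDiff_hamiltonian {m : WithTop ℕ∞} {τ : ℝ} (hτ : 0 < τ) :
    ContDiff ℝ m (hamiltonian (n := n) τ) := by
  rw [hamiltonian_eq]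
  exact contDiff_kinetic.sub (contDiff_const.mul ((contDiff_const.div
    (contDiff_const.add (contDiff_const.mul contDiff_sqRadius))
    fun s => (one_add_pos hτ s).ne').mul (contDiff_rotation.pow 2)))

theorem fderiv_kinetic (s v : Phase n) :
    fderiv ℝ kinetic s v = ∑ k, (momX k s * dmomX k s v + s.2 (iy k) * v.2 (iy k)) := by
  have h := (HasFDerivAt.fun_sum (u := Finset.univ) fun k (_ : k ∈ Finset.univ) =>
    ((hasFDerivAt_momX k s).pow 2).add ((hasFDerivAt_p (iy k) s).pow 2)).const_mul (1 / 2 : ℝ)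
  rw [show fderiv ℝ kinetic s = _ from h.fderiv]
  simp only [smul_apply, sum_apply, add_apply, dq_apply, dp_apply, smul_eq_mul, Finset.mul_sum]
  exact Finset.sum_congr rfl fun k _ => by simp only [dmomX]; simp; ring

theorem fderiv_rotation (s v : Phase n) :
    fderiv ℝ rotation s v = ∑ k, (v.1 (ix k) * s.2 (iy k) + s.1 (ix k) * v.2 (iy k) -
      (v.1 (iy k) * momX k s + s.1 (iy k) * dmomX k s v)) := by
  have h := HasFDerivAt.fun_sum (u := Finset.univ) fun k (_ : k ∈ Finset.univ) =>
    ((hasFDerivAt_q (ix k) s).mul (hasFDerivAt_p (iy k) s)).sub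
      ((hasFDerivAt_q (iy k) s).mul (hasFDerivAt_momX k s))
  rw [show fderiv ℝ rotation s = _ from h.fderiv]
  simp only [smul_apply, sum_apply, add_apply, sub_apply, dq_apply, dp_apply, smul_eq_mul]
  exact Finset.sum_congr rfl fun k _ => by simp only [dmomX]; ring

theorem fderiv_sqRadius (s v : Phase n) :
    fderiv ℝ sqRadius s v =
      ∑ k, (2 * s.1 (ix k) * v.1 (ix k) + 2 * s.1 (iy k) * v.1 (iy k)) := by
  have h := HasFDerivAt.fun_sum (u := Finset.univ) fun k (_ : k ∈ Finset.univ) =>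
    ((hasFDerivAt_q (ix k) s).pow 2).add ((hasFDerivAt_q (iy k) s).pow 2)
  rw [show fderiv ℝ sqRadius s = _ from h.fderiv]
  simp

theorem fderiv_dilation (s v : Phase n) :
    fderiv ℝ dilation s v = ∑ k, (v.1 (ix k) * momX k s + s.1 (ix k) * dmomX k s v +
      (v.1 (iy k) * s.2 (iy k) + s.1 (iy k) * v.2 (iy k))) := by
  have h := HasFDerivAt.fun_sum (u := Finset.univ) fun k (_ : k ∈ Finset.univ) =>
    ((hasFDerivAt_q (ix k) s).mul (hasFDerivAt_momX k s)).add
      ((hasFDerivAt_q (iy k) s).mul (hasFDerivAt_p (iy k) s))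
  rw [show fderiv ℝ dilation s = _ from h.fderiv]
  simp only [smul_apply, sum_apply, add_apply, dq_apply, dp_apply, smul_eq_mul]
  exact Finset.sum_congr rfl fun k _ => by simp only [dmomX]; ring

theorem fderiv_casimir (s : Phase n) :
    fderiv ℝ casimir s = (2 * kinetic s) • fderiv ℝ sqRadius s +
      (2 * sqRadius s) • fderiv ℝ kinetic s - (2 * dilation s) • fderiv ℝ dilation s -
      (2 * rotation s) • fderiv ℝ rotation s := by
  have hT := (contDiff_kinetic (m := 1) (n := n)).differentiable (by simp) s |>.hasFDerivAt
  have hR := (contDiff_sqRadius (m := 1) (n := n)).differentiable (by simp) s |>.hasFDerivAt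
  have hD := (contDiff_dilation (m := 1) (n := n)).differentiable (by simp) s |>.hasFDerivAt
  have hK := (contDiff_rotation (m := 1) (n := n)).differentiable (by simp) s |>.hasFDerivAt
  have h := (((hR.const_mul 2).mul hT).sub (hD.pow 2)).sub (hK.pow 2)
  rw [show fderiv ℝ casimir s = _ from h.fderiv]
  ext v <;> simp <;> ring

/-- Chain rule for a function of T, K and R. The partial derivatives are 1, -σ and σ²/2 with σ =
τK/(1 + τR), the quantity later called `spin`. -/
theorem fderiv_hamiltonian {τ : ℝ} (hτ : 0 < τ) (s : Phase n) :
    fderiv ℝ (hamiltonian τ) s = fderiv ℝ kinetic s -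
      (τ * rotation s / (1 + τ * sqRadius s)) • fderiv ℝ rotation s +
      (1 / 2 * (τ * rotation s / (1 + τ * sqRadius s)) ^ 2) • fderiv ℝ sqRadius s := by
  have hpos := (one_add_pos hτ s).ne'
  have hT := (contDiff_kinetic (m := 1) (n := n)).differentiable (by simp) s |>.hasFDerivAt
  have hR := (contDiff_sqRadius (m := 1) (n := n)).differentiable (by simp) s |>.hasFDerivAt
  have hK := (contDiff_rotation (m := 1) (n := n)).differentiable (by simp) s |>.hasFDerivAt
  have h := hT.sub (((((hasDerivAt_inv hpos).comp_hasFDerivAt s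
    ((hR.const_mul τ).const_add 1)).const_mul τ).mul (hK.pow 2)).const_mul (1 / 2 : ℝ))
  simp only [hamiltonian_eq, div_eq_mul_inv τ]
  refine HasFDerivAt.fderiv (HasFDerivAt.congr_fderiv h ?_)
  refine ContinuousLinearMap.ext fun v => ?_
  simp
  field_simp
  ring

theorem fderiv_pairIm (a b : Fin n) (s v : Phase n) :
    fderiv ℝ (pairIm a b) s v =
      v.1 (iy b) * s.2 (ix a) + s.1 (iy b) * v.2 (ix a)
        - (v.1 (ix a) * s.2 (iy b) + s.1 (ix a) * v.2 (iy b))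
        + (v.1 (ix b) * s.2 (iy a) + s.1 (ix b) * v.2 (iy a))
        - (v.1 (iy a) * s.2 (ix b) + s.1 (iy a) * v.2 (ix b)) := by
  have h := ((((hasFDerivAt_q (iy b) s).mul (hasFDerivAt_p (ix a) s)).sub
    ((hasFDerivAt_q (ix a) s).mul (hasFDerivAt_p (iy b) s))).add
    ((hasFDerivAt_q (ix b) s).mul (hasFDerivAt_p (iy a) s))).sub
    ((hasFDerivAt_q (iy a) s).mul (hasFDerivAt_p (ix b) s))
  rw [show fderiv ℝ (pairIm a b) s = _ from h.fderiv]
  simp only [smul_apply, add_apply, sub_apply, dq_apply, dp_apply, smul_eq_mul]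
  ring

theorem fderiv_pairRe (a b : Fin n) (s v : Phase n) :
    fderiv ℝ (pairRe a b) s v =
      v.1 (ix a) * s.2 (ix b) + s.1 (ix a) * v.2 (ix b)
        - (v.1 (ix b) * s.2 (ix a) + s.1 (ix b) * v.2 (ix a))
        - (v.1 (iy a) * s.2 (iy b) + s.1 (iy a) * v.2 (iy b))
        + (v.1 (iy b) * s.2 (iy a) + s.1 (iy b) * v.2 (iy a))
        + (v.1 (ix a) * s.1 (iy b) + s.1 (ix a) * v.1 (iy b)
          - (v.1 (ix b) * s.1 (iy a) + s.1 (ix b) * v.1 (iy a))) * s.2 iz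
        + (s.1 (ix a) * s.1 (iy b) - s.1 (ix b) * s.1 (iy a)) * v.2 iz := by
  have h := (((((hasFDerivAt_q (ix a) s).mul (hasFDerivAt_p (ix b) s)).sub
    ((hasFDerivAt_q (ix b) s).mul (hasFDerivAt_p (ix a) s))).sub
    ((hasFDerivAt_q (iy a) s).mul (hasFDerivAt_p (iy b) s))).add
    ((hasFDerivAt_q (iy b) s).mul (hasFDerivAt_p (iy a) s))).add
    ((((hasFDerivAt_q (ix a) s).mul (hasFDerivAt_q (iy b) s)).sub
    ((hasFDerivAt_q (ix b) s).mul (hasFDerivAt_q (iy a) s))).mul (hasFDerivAt_p iz s))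
  rw [show fderiv ℝ (pairRe a b) s = _ from h.fderiv]
  simp only [smul_apply, add_apply, sub_apply, dq_apply, dp_apply, smul_eq_mul, Pi.sub_apply,
    Pi.mul_apply]
  ring

theorem fderiv_pairIntegral (a b : Fin n) (s : Phase n) :
    fderiv ℝ (pairIntegral a b) s = (2 * pairIm a b s) • fderiv ℝ (pairIm a b) s +
      (2 * pairRe a b s) • fderiv ℝ (pairRe a b) s := by
  have h1 := (contDiff_pairIm (m := 1) a b).differentiable (by simp) s |>.hasFDerivAt
  have h2 := (contDiff_pairRe (m := 1) a b).differentiable (by simp) s |>.hasFDerivAt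
  rw [show fderiv ℝ (pairIntegral a b) s = _ from ((h1.pow 2).add (h2.pow 2)).fderiv]
  simp

theorem fderiv_angularIntegral (j : Fin n) (s v : Phase n) :
    fderiv ℝ (angularIntegral j) s v =
      v.1 (ix j) * s.2 (iy j) + s.1 (ix j) * v.2 (iy j)
        - (v.1 (iy j) * s.2 (ix j) + s.1 (iy j) * v.2 (ix j))
        + (s.1 (ix j) * v.1 (ix j) - s.1 (iy j) * v.1 (iy j)) * s.2 iz
        + 1 / 2 * (s.1 (ix j) ^ 2 - s.1 (iy j) ^ 2) * v.2 iz := by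
  have h := (((hasFDerivAt_q (ix j) s).mul (hasFDerivAt_p (iy j) s)).sub
    ((hasFDerivAt_q (iy j) s).mul (hasFDerivAt_p (ix j) s))).add
    (((((hasFDerivAt_q (ix j) s).pow 2).sub ((hasFDerivAt_q (iy j) s).pow 2)).const_mul
      (1 / 2 : ℝ)).mul (hasFDerivAt_p iz s))
  rw [show fderiv ℝ (angularIntegral j) s = _ from h.fderiv]
  simp
  ring

theorem fderiv_center (s : Phase n) : fderiv ℝ (fun s : Phase n => s.2 iz) s = dp iz :=
  (hasFDerivAt_p iz s).fderiv

/-! ### Hamiltonian vector fields and brackets -/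

section Mechanics

variable {ι : Type} [DecidableEq ι]

theorem sharp_add (α β : (ι → ℝ) × (ι → ℝ) →L[ℝ] ℝ) : sharp (α + β) = sharp α + sharp β := by
  ext i
  · simp [sharp]
  · simp [sharp]; ring

theorem sharp_sub (α β : (ι → ℝ) × (ι → ℝ) →L[ℝ] ℝ) : sharp (α - β) = sharp α - sharp β := by
  ext i
  · simp [sharp]
  · simp [sharp]; ring

theorem sharp_smul (r : ℝ) (α : (ι → ℝ) × (ι → ℝ) →L[ℝ] ℝ) : sharp (r • α) = r • sharp α := by
  ext i <;> simp [sharp]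

end Mechanics

theorem sharp_kinetic (s : Phase n) : sharp (fderiv ℝ kinetic s) =
    (Sum.elim (Sum.elim (fun k => momX k s) fun k => s.2 (iy k))
        (fun _ => ∑ k, s.1 (iy k) * momX k s),
      Sum.elim (Sum.elim (fun _ => 0) fun k => -(s.2 iz * momX k s)) fun _ => 0) := by
  ext ((i | i) | i) <;> simp [sharp, fderiv_kinetic, dmomX, Pi.single_apply, mul_comm]

theorem sharp_rotation (s : Phase n) : sharp (fderiv ℝ rotation s) =
    (Sum.elim (Sum.elim (fun k => -s.1 (iy k)) fun k => s.1 (ix k))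
        (fun _ => -∑ k, s.1 (iy k) ^ 2),
      Sum.elim (Sum.elim (fun k => -s.2 (iy k)) fun k => momX k s + s.1 (iy k) * s.2 iz)
        fun _ => 0) := by
  ext ((i | i) | i) <;>
    simp [sharp, fderiv_rotation, dmomX, Pi.single_apply, Finset.sum_add_distrib, sq]

theorem sharp_sqRadius (s : Phase n) : sharp (fderiv ℝ sqRadius s) =
    (0, Sum.elim (Sum.elim (fun k => -(2 * s.1 (ix k))) fun k => -(2 * s.1 (iy k)))
        fun _ => 0) := by
  ext ((i | i) | i) <;>
    simp [sharp, fderiv_sqRadius, Pi.single_apply]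

theorem sharp_dilation (s : Phase n) : sharp (fderiv ℝ dilation s) =
    (Sum.elim (Sum.elim (fun k => s.1 (ix k)) fun k => s.1 (iy k))
        (fun _ => ∑ k, s.1 (ix k) * s.1 (iy k)),
      Sum.elim (Sum.elim (fun k => -momX k s) fun k => -(s.1 (ix k) * s.2 iz + s.2 (iy k)))
        fun _ => 0) := by
  ext ((i | i) | i) <;>
    simp [sharp, fderiv_dilation, dmomX, Pi.single_apply, Finset.sum_add_distrib]

theorem sharp_center : sharp (dp iz : Phase n →L[ℝ] ℝ) = (Pi.single iz 1, 0) := by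
  ext ((i | i) | i) <;> simp [sharp, Pi.single_apply]

theorem sharp_angular (j : Fin n) (s : Phase n) : sharp (fderiv ℝ (angularIntegral j) s) =
    (Sum.elim (Sum.elim (fun k => if k = j then -s.1 (iy j) else 0)
          fun k => if k = j then s.1 (ix j) else 0)
        (fun _ => 1 / 2 * (s.1 (ix j) ^ 2 - s.1 (iy j) ^ 2)),
      Sum.elim (Sum.elim (fun k => if k = j then -(s.2 (iy j) + s.1 (ix j) * s.2 iz) else 0)
        fun k => if k = j then s.2 (ix j) + s.1 (iy j) * s.2 iz else 0) fun _ => 0) := by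
  ext ((i | i) | i)
  all_goals
    simp only [sharp, fderiv_angularIntegral, Pi.single_apply]
    try by_cases h : i = j
    all_goals simp_all [eq_comm]
    try ring

/-- A covector that annihilates the Hamiltonian fields of `kinetic`, `rotation` and `sqRadius`
annihilates that of the Hamiltonian. -/
theorem apply_sharp_hamiltonian {τ : ℝ} (hτ : 0 < τ) {s : Phase n} {α : Phase n →L[ℝ] ℝ}
    (hT : α (sharp (fderiv ℝ kinetic s)) = 0) (hK : α (sharp (fderiv ℝ rotation s)) = 0)
    (hR : α (sharp (fderiv ℝ sqRadius s)) = 0) :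
    α (sharp (fderiv ℝ (hamiltonian τ) s)) = 0 := by
  rw [fderiv_hamiltonian hτ, sharp_add, sharp_sub, sharp_smul, sharp_smul]
  simp [hT, hK, hR]

theorem apply_sharp_casimir {s : Phase n} {α : Phase n →L[ℝ] ℝ}
    (hT : α (sharp (fderiv ℝ kinetic s)) = 0) (hK : α (sharp (fderiv ℝ rotation s)) = 0)
    (hR : α (sharp (fderiv ℝ sqRadius s)) = 0) (hD : α (sharp (fderiv ℝ dilation s)) = 0) :
    α (sharp (fderiv ℝ casimir s)) = 0 := by
  rw [fderiv_casimir, sharp_sub, sharp_sub, sharp_add]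
  simp [sharp_smul, hT, hK, hR, hD]

/-- With λ = λ_{2n+1}, the flow of T is z' = P, P' = -iλP. That of K is z' = iz, P' = iP + λz, that
of R is z' = 0, P' = -2z, and that of D is z' = z, P' = -P - iλz. Each multiplies z_a P_b - z_b P_a
by the trace of its matrix, infinitesimally; the traces -iλ, 2i, 0, 0 are imaginary, so the modulus
is constant. This covers the next three lemmas as well. -/
theorem pair_kinetic (a b : Fin n) (s : Phase n) :
    fderiv ℝ (pairIntegral a b) s (sharp (fderiv ℝ kinetic s)) = 0 := by
  simp [fderiv_pairIntegral, fderiv_pairIm, fderiv_pairRe, sharp_kinetic, pairIm, pairRe, momX]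
  ring

theorem pair_rotation (a b : Fin n) (s : Phase n) :
    fderiv ℝ (pairIntegral a b) s (sharp (fderiv ℝ rotation s)) = 0 := by
  simp [fderiv_pairIntegral, fderiv_pairIm, fderiv_pairRe, sharp_rotation, pairIm, pairRe, momX]
  ring

theorem pair_sqRadius (a b : Fin n) (s : Phase n) :
    fderiv ℝ (pairIntegral a b) s (sharp (fderiv ℝ sqRadius s)) = 0 := by
  simp [fderiv_pairIntegral, fderiv_pairIm, fderiv_pairRe, sharp_sqRadius, pairIm, pairRe]
  ring

theorem pair_dilation (a b : Fin n) (s : Phase n) :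
    fderiv ℝ (pairIntegral a b) s (sharp (fderiv ℝ dilation s)) = 0 := by
  simp [fderiv_pairIntegral, fderiv_pairIm, fderiv_pairRe, sharp_dilation, pairIm, pairRe, momX]
  ring

theorem pair_center (a b : Fin n) (s : Phase n) :
    fderiv ℝ (pairIntegral a b) s (sharp (dp iz)) = 0 := by
  simp [fderiv_pairIntegral, fderiv_pairIm, fderiv_pairRe, sharp_center]

/-- The flow of the angular integral is z_j' = iz_j, P_j' = iP_j, so z_a P_b - z_b P_a acquires a
phase if j is one of a, b and stays fixed otherwise. -/
theorem pair_angular (a b j : Fin n) (s : Phase n) :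
    fderiv ℝ (pairIntegral a b) s (sharp (fderiv ℝ (angularIntegral j) s)) = 0 := by
  by_cases ha : a = j <;> by_cases hb : b = j <;>
    simp [fderiv_pairIntegral, fderiv_pairIm, fderiv_pairRe, sharp_angular, pairIm, pairRe, ha, hb]
    <;> ring

/-- Rotating z_j and P_j by a common phase preserves all Hermitian products of z and P, hence T, K,
R and D. -/
theorem angular_kinetic (j : Fin n) (s : Phase n) :
    fderiv ℝ (angularIntegral j) s (sharp (fderiv ℝ kinetic s)) = 0 := by
  simp [fderiv_angularIntegral, sharp_kinetic, momX]
  ring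

theorem angular_rotation (j : Fin n) (s : Phase n) :
    fderiv ℝ (angularIntegral j) s (sharp (fderiv ℝ rotation s)) = 0 := by
  simp [fderiv_angularIntegral, sharp_rotation, momX]
  ring

theorem angular_sqRadius (j : Fin n) (s : Phase n) :
    fderiv ℝ (angularIntegral j) s (sharp (fderiv ℝ sqRadius s)) = 0 := by
  simp [fderiv_angularIntegral, sharp_sqRadius]
  ring

theorem angular_dilation (j : Fin n) (s : Phase n) :
    fderiv ℝ (angularIntegral j) s (sharp (fderiv ℝ dilation s)) = 0 := by
  simp [fderiv_angularIntegral, sharp_dilation, momX]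
  ring

theorem angular_center (j : Fin n) (s : Phase n) :
    fderiv ℝ (angularIntegral j) s (sharp (dp iz)) = 0 := by
  simp [fderiv_angularIntegral, sharp_center]

theorem angular_angular (i j : Fin n) (s : Phase n) :
    fderiv ℝ (angularIntegral i) s (sharp (fderiv ℝ (angularIntegral j) s)) = 0 := by
  by_cases h : i = j <;> simp [fderiv_angularIntegral, sharp_angular, h]
  ring

/-- The Casimir function is the Gram determinant of z and P. As for a single component of z ∧ P, the
flow only multiplies the bivector by a phase. The computation uses that the brackets of T, R, D, K
close on these functions, with coefficients affine in λ_{2n+1}. -/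
theorem casimir_kinetic (s : Phase n) :
    fderiv ℝ casimir s (sharp (fderiv ℝ kinetic s)) = 0 := by
  have hR : fderiv ℝ sqRadius s (sharp (fderiv ℝ kinetic s)) = 2 * dilation s := by
    simp only [fderiv_sqRadius, sharp_kinetic, dilation, Finset.mul_sum]
    exact Finset.sum_congr rfl fun k _ => by simp; ring
  have hT : fderiv ℝ kinetic s (sharp (fderiv ℝ kinetic s)) = 0 := by
    simp only [fderiv_kinetic, sharp_kinetic]
    exact Finset.sum_eq_zero fun k _ => by simp [dmomX]; ring
  have hD : fderiv ℝ dilation s (sharp (fderiv ℝ kinetic s)) =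
      2 * kinetic s + s.2 iz * rotation s := by
    simp only [fderiv_dilation, sharp_kinetic, kinetic, rotation, Finset.mul_sum,
      ← Finset.sum_add_distrib]
    exact Finset.sum_congr rfl fun k _ => by simp [dmomX]; ring
  have hK : fderiv ℝ rotation s (sharp (fderiv ℝ kinetic s)) = -(s.2 iz * dilation s) := by
    simp only [fderiv_rotation, sharp_kinetic, dilation, Finset.mul_sum, ← Finset.sum_neg_distrib]
    exact Finset.sum_congr rfl fun k _ => by simp [dmomX]; ring
  simp only [fderiv_casimir, add_apply, sub_apply, smul_apply, smul_eq_mul, hR, hT, hD, hK]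
  ring

theorem casimir_rotation (s : Phase n) :
    fderiv ℝ casimir s (sharp (fderiv ℝ rotation s)) = 0 := by
  have hR : fderiv ℝ sqRadius s (sharp (fderiv ℝ rotation s)) = 0 := by
    simp only [fderiv_sqRadius, sharp_rotation]
    exact Finset.sum_eq_zero fun k _ => by simp; ring
  have hT : fderiv ℝ kinetic s (sharp (fderiv ℝ rotation s)) = s.2 iz * dilation s := by
    simp only [fderiv_kinetic, sharp_rotation, dilation, Finset.mul_sum]
    exact Finset.sum_congr rfl fun k _ => by simp [dmomX]; ring
  have hD : fderiv ℝ dilation s (sharp (fderiv ℝ rotation s)) = s.2 iz * sqRadius s := by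
    simp only [fderiv_dilation, sharp_rotation, sqRadius, Finset.mul_sum]
    exact Finset.sum_congr rfl fun k _ => by simp [dmomX]; ring
  have hK : fderiv ℝ rotation s (sharp (fderiv ℝ rotation s)) = 0 := by
    rw [← poissonBracket_eq_apply_sharp, poissonBracket_self, Pi.zero_apply]
  simp only [fderiv_casimir, add_apply, sub_apply, smul_apply, smul_eq_mul, hR, hT, hD, hK]
  ring

theorem casimir_sqRadius (s : Phase n) :
    fderiv ℝ casimir s (sharp (fderiv ℝ sqRadius s)) = 0 := by
  have hR : fderiv ℝ sqRadius s (sharp (fderiv ℝ sqRadius s)) = 0 := by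
    rw [← poissonBracket_eq_apply_sharp, poissonBracket_self, Pi.zero_apply]
  have hT : fderiv ℝ kinetic s (sharp (fderiv ℝ sqRadius s)) = -(2 * dilation s) := by
    simp only [fderiv_kinetic, sharp_sqRadius, dilation, Finset.mul_sum, ← Finset.sum_neg_distrib]
    exact Finset.sum_congr rfl fun k _ => by simp [dmomX]; ring
  have hD : fderiv ℝ dilation s (sharp (fderiv ℝ sqRadius s)) = -(2 * sqRadius s) := by
    simp only [fderiv_dilation, sharp_sqRadius, sqRadius, Finset.mul_sum, ← Finset.sum_neg_distrib]
    exact Finset.sum_congr rfl fun k _ => by simp [dmomX]; ring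
  have hK : fderiv ℝ rotation s (sharp (fderiv ℝ sqRadius s)) = 0 := by
    simp only [fderiv_rotation, sharp_sqRadius]
    exact Finset.sum_eq_zero fun k _ => by simp [dmomX]; ring
  simp only [fderiv_casimir, add_apply, sub_apply, smul_apply, smul_eq_mul, hR, hT, hD, hK]
  ring

theorem casimir_center (s : Phase n) : fderiv ℝ casimir s (sharp (dp iz)) = 0 := by
  simp [fderiv_casimir, fderiv_sqRadius, fderiv_kinetic, fderiv_dilation, fderiv_rotation,
    sharp_center, dmomX]

theorem hamiltonian_center {τ : ℝ} (hτ : 0 < τ) (s : Phase n) :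
    fderiv ℝ (hamiltonian τ) s (sharp (dp iz)) = 0 := by
  simp [fderiv_hamiltonian hτ, fderiv_sqRadius, fderiv_kinetic, fderiv_rotation,
    sharp_center, dmomX]

/-! ### Brackets of two pair integrals -/

/-- The real part of `z_b P̄_k - P_b z̄_k - i λ_{2n+1} z_b z̄_k`. -/
def mixedRe (b k : Fin n) (s : Phase n) : ℝ :=
  s.1 (ix b) * momX k s + s.1 (iy b) * s.2 (iy k) - momX b s * s.1 (ix k)
    - s.2 (iy b) * s.1 (iy k) + s.2 iz * (s.1 (iy b) * s.1 (ix k) - s.1 (ix b) * s.1 (iy k))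

/-- The imaginary part of `z_b P̄_k - P_b z̄_k - i λ_{2n+1} z_b z̄_k`. -/
def mixedIm (b k : Fin n) (s : Phase n) : ℝ :=
  s.1 (iy b) * momX k s - s.1 (ix b) * s.2 (iy k) - s.2 (iy b) * s.1 (ix k)
    + momX b s * s.1 (iy k) - s.2 iz * (s.1 (ix b) * s.1 (ix k) + s.1 (iy b) * s.1 (iy k))

/-- Put W_b = z_a P_b - z_b P_a = `pairRe` - i `pairIm`. Since a, b, k are distinct, only the
canonical pairs with index a contribute. They give {W_b, W_k} = 0 and {W_b, W̄_k} = 2(`mixedRe` + i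
`mixedIm`), and the product rule for |W_b|² and |W_k|² does the rest. The explicit form makes the
differential at the base point computable. -/
theorem poissonBracket_pair_pair {a b k : Fin n} (hab : a ≠ b) (hak : a ≠ k) (hbk : b ≠ k) :
    poissonBracket (pairIntegral a b) (pairIntegral a k) = fun s =>
      4 * ((pairRe a b s * pairRe a k s + pairIm a b s * pairIm a k s) * mixedRe b k s +
        (pairRe a b s * pairIm a k s - pairIm a b s * pairRe a k s) * mixedIm b k s) := by
  funext s
  have h1 : fderiv ℝ (pairRe a b) s (sharp (fderiv ℝ (pairRe a k) s)) = mixedRe b k s := by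
    simp [sharp, fderiv_pairRe, Pi.single_apply, hab, hak.symm, hbk.symm, mixedRe, momX]
    ring
  have h2 : fderiv ℝ (pairIm a b) s (sharp (fderiv ℝ (pairIm a k) s)) = mixedRe b k s := by
    simp [sharp, fderiv_pairIm, Pi.single_apply, hab, hak.symm, hbk.symm, mixedRe, momX]
    ring
  have h3 : fderiv ℝ (pairIm a b) s (sharp (fderiv ℝ (pairRe a k) s)) = -mixedIm b k s := by
    simp [sharp, fderiv_pairIm, fderiv_pairRe, Pi.single_apply, hab, hak.symm, hbk.symm,
      mixedIm, momX]
    ring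
  have h4 : fderiv ℝ (pairRe a b) s (sharp (fderiv ℝ (pairIm a k) s)) = mixedIm b k s := by
    simp [sharp, fderiv_pairIm, fderiv_pairRe, Pi.single_apply, hab, hak.symm, hbk.symm,
      mixedIm, momX]
    ring
  rw [poissonBracket_eq_apply_sharp, fderiv_pairIntegral, fderiv_pairIntegral, sharp_add,
    sharp_smul, sharp_smul]
  simp only [map_add, map_smul, add_apply, smul_apply, smul_eq_mul, h1, h2, h3, h4]
  ring

/-! ### First integrals and the functions that commute with all of them -/

/-- The labels of a maximal involutive family commuting with all first integrals; the last summand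
has one element if `n ≥ 2` and none otherwise. -/
abbrev CentralIndex (n : ℕ) : Type := Option (Option (Fin n ⊕ {k : Fin n // k.val = 1}))

/-- The Hamiltonian, the angular integrals, `λ_{2n+1}` and, if `n ≥ 2`, the Casimir function. -/
def centralFunction (τ : ℝ) : CentralIndex n → Phase n → ℝ
  | none => hamiltonian τ
  | some none => fun s => s.2 iz
  | some (some (Sum.inl j)) => angularIntegral j
  | some (some (Sum.inr _)) => casimir

theorem contDiff_centralFunction {m : WithTop ℕ∞} {τ : ℝ} (hτ : 0 < τ) :
    ∀ i : CentralIndex n, ContDiff ℝ m (centralFunction τ i)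
  | none => contDiff_hamiltonian hτ
  | some none => contDiff_p iz
  | some (some (Sum.inl j)) => contDiff_angularIntegral j
  | some (some (Sum.inr _)) => contDiff_casimir

theorem poissonBracket_pair_central {τ : ℝ} (hτ : 0 < τ) (a b : Fin n) (i : CentralIndex n) :
    poissonBracket (pairIntegral a b) (centralFunction τ i) = 0 := by
  funext s
  rw [poissonBracket_eq_apply_sharp, Pi.zero_apply]
  match i with
  | none =>
    exact apply_sharp_hamiltonian hτ (pair_kinetic a b s) (pair_rotation a b s)
      (pair_sqRadius a b s)
  | some none => exact (fderiv_center s).symm ▸ pair_center a b s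
  | some (some (Sum.inl j)) => exact pair_angular a b j s
  | some (some (Sum.inr _)) =>
    exact apply_sharp_casimir (pair_kinetic a b s) (pair_rotation a b s)
      (pair_sqRadius a b s) (pair_dilation a b s)

theorem poissonBracket_angular_central {τ : ℝ} (hτ : 0 < τ) (j : Fin n) (i : CentralIndex n) :
    poissonBracket (angularIntegral j) (centralFunction τ i) = 0 := by
  funext s
  rw [poissonBracket_eq_apply_sharp, Pi.zero_apply]
  match i with
  | none =>
    exact apply_sharp_hamiltonian hτ (angular_kinetic j s) (angular_rotation j s)
      (angular_sqRadius j s)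
  | some none => exact (fderiv_center s).symm ▸ angular_center j s
  | some (some (Sum.inl k)) => exact angular_angular j k s
  | some (some (Sum.inr _)) =>
    exact apply_sharp_casimir (angular_kinetic j s) (angular_rotation j s)
      (angular_sqRadius j s) (angular_dilation j s)

theorem poissonBracket_hamiltonian_center {τ : ℝ} (hτ : 0 < τ) :
    poissonBracket (hamiltonian τ) (fun s : Phase n => s.2 iz) = 0 := by
  funext s
  rw [poissonBracket_eq_apply_sharp, fderiv_center]
  exact hamiltonian_center hτ s

theorem poissonBracket_casimir_center :
    poissonBracket casimir (fun s : Phase n => s.2 iz) = 0 := by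
  funext s
  rw [poissonBracket_eq_apply_sharp, fderiv_center]
  exact casimir_center s

theorem poissonBracket_casimir_hamiltonian {τ : ℝ} (hτ : 0 < τ) :
    poissonBracket (casimir (n := n)) (hamiltonian τ) = 0 := by
  funext s
  rw [poissonBracket_eq_apply_sharp]
  exact apply_sharp_hamiltonian hτ (casimir_kinetic s) (casimir_rotation s) (casimir_sqRadius s)

theorem poissonBracket_central_central {τ : ℝ} (hτ : 0 < τ) (i j : CentralIndex n) :
    poissonBracket (centralFunction τ i) (centralFunction τ j) = 0 := by
  match i, j with
  | some (some (Sum.inl k)), j => exact poissonBracket_angular_central hτ k j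
  | i, some (some (Sum.inl k)) =>
    exact poissonBracket_comm_zero (poissonBracket_angular_central hτ k i)
  | none, none => exact poissonBracket_self _
  | none, some none => exact poissonBracket_hamiltonian_center hτ
  | none, some (some (Sum.inr _)) =>
    exact poissonBracket_comm_zero (poissonBracket_casimir_hamiltonian hτ)
  | some none, none => exact poissonBracket_comm_zero (poissonBracket_hamiltonian_center hτ)
  | some none, some none => exact poissonBracket_self _
  | some none, some (some (Sum.inr _)) =>
    exact poissonBracket_comm_zero poissonBracket_casimir_center
  | some (some (Sum.inr _)), none => exact poissonBracket_casimir_hamiltonian hτ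
  | some (some (Sum.inr _)), some none => exact poissonBracket_casimir_center
  | some (some (Sum.inr _)), some (some (Sum.inr _)) => exact poissonBracket_self _

theorem contDiff_firstIntegral {m : WithTop ℕ∞} (hm : m + 1 ≤ m) {τ : ℝ} (hτ : 0 < τ) :
    ∀ i : IntegralIndex n, ContDiff ℝ m (firstIntegral τ i)
  | .energy => contDiff_hamiltonian hτ
  | .angular j => contDiff_angularIntegral j
  | .pair k _ => contDiff_pairIntegral _ k
  | .center => contDiff_p iz
  | .bracket _ _ =>
    contDiff_poissonBracket hm (contDiff_pairIntegral _ _) (contDiff_pairIntegral _ _)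

theorem poissonBracket_firstIntegral_central {τ : ℝ} (hτ : 0 < τ) (i : IntegralIndex n)
    (j : CentralIndex n) : poissonBracket (firstIntegral τ i) (centralFunction τ j) = 0 := by
  match i with
  | .energy => exact poissonBracket_central_central hτ none j
  | .angular k => exact poissonBracket_angular_central hτ k j
  | .pair k _ => exact poissonBracket_pair_central hτ _ k j
  | .center => exact poissonBracket_central_central hτ (some none) j
  | .bracket k _ =>
    exact poissonBracket_bracket_eq_zero (contDiff_pairIntegral _ _) (contDiff_pairIntegral _ _)
      (contDiff_centralFunction hτ j) (poissonBracket_pair_central hτ _ _ j)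
      (poissonBracket_pair_central hτ _ _ j)

/-- For n ≤ 2 there are no bracket labels and at most one pair label. All other labels name
functions of the involutive family, which commutes with every first integral. -/
theorem poissonBracket_firstIntegral_firstIntegral (hn : n ≤ 2) {τ : ℝ} (hτ : 0 < τ)
    (i j : IntegralIndex n) :
    poissonBracket (firstIntegral τ i) (firstIntegral τ j) = 0 := by
  have hb : ∀ k : Fin n, ¬ 1 < k.val := fun k => by omega
  match i, j with
  | .bracket k hk, _ => exact absurd hk (hb k)
  | _, .bracket k hk => exact absurd hk (hb k)
  | i, .energy => exact poissonBracket_firstIntegral_central hτ i none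
  | i, .center => exact poissonBracket_firstIntegral_central hτ i (some none)
  | i, .angular k => exact poissonBracket_firstIntegral_central hτ i (some (some (Sum.inl k)))
  | .energy, j =>
    exact poissonBracket_comm_zero (poissonBracket_firstIntegral_central hτ j none)
  | .center, j =>
    exact poissonBracket_comm_zero (poissonBracket_firstIntegral_central hτ j (some none))
  | .angular k, j =>
    exact poissonBracket_comm_zero
      (poissonBracket_firstIntegral_central hτ j (some (some (Sum.inl k))))
  | .pair k hk, .pair l hl =>
    obtain rfl : k = l := by ext; omega
    exact poissonBracket_self _

/-! ### Functional independence -/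

/-- A point where the differentials of the first integrals are independent. -/
def basePoint (n : ℕ) : Phase n :=
  (Sum.elim (Sum.elim (fun k => if k.val = 0 then 0 else 1) fun _ => 0) fun _ => 0,
    Sum.elim (Sum.elim (fun k => if k.val = 0 then 1 else 0) fun _ => 0) fun _ => 0)

/-- Coordinate vectors that separate the differentials of the first integrals at `basePoint`. -/
def testVector (hn : 0 < n) : IntegralIndex n → Phase n
  | .energy => (0, Pi.single (ix ⟨0, hn⟩) 1)
  | .angular j => if j.val = 0 then (Pi.single (iy j) 1, 0) else (0, Pi.single (iy j) 1)
  | .pair k _ => (Pi.single (ix k) 1, 0)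
  | .center => (0, Pi.single iz 1)
  | .bracket k _ => (0, Pi.single (ix k) 1)

theorem momX_basePoint (k : Fin n) : momX k (basePoint n) = if k.val = 0 then 1 else 0 := by
  simp [momX, basePoint]

theorem dmomX_basePoint (k : Fin n) (v : Phase n) : dmomX k (basePoint n) v = v.2 (ix k) := by
  simp [dmomX, basePoint]

theorem rotation_basePoint : rotation (basePoint n) = 0 := by
  simp [rotation, basePoint]

theorem dilation_basePoint : dilation (basePoint n) = 0 := by
  refine Finset.sum_eq_zero fun k _ => ?_
  rw [momX_basePoint]
  by_cases hk : k.val = 0 <;> simp [basePoint, hk]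

theorem fderiv_kinetic_basePoint (hn : 0 < n) (v : Phase n) :
    fderiv ℝ kinetic (basePoint n) v = v.2 (ix ⟨0, hn⟩) := by
  simp only [fderiv_kinetic, momX_basePoint, dmomX_basePoint]
  rw [Finset.sum_eq_single ⟨0, hn⟩]
  · simp [basePoint]
  · intro k _ hk
    have : k.val ≠ 0 := fun h => hk (Fin.ext h)
    simp [basePoint, this]
  · simp

theorem kinetic_basePoint (hn : 0 < n) : kinetic (basePoint n) = 1 / 2 := by
  simp only [kinetic, momX_basePoint]
  rw [Finset.sum_eq_single ⟨0, hn⟩]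
  · simp [basePoint]
  · intro k _ hk
    have : k.val ≠ 0 := fun h => hk (Fin.ext h)
    simp [basePoint, this]
  · simp

/-- Every term with τ carries the factor K, which vanishes at the base point, so independence can be
checked uniformly in τ. -/
theorem fderiv_hamiltonian_basePoint (hn : 0 < n) {τ : ℝ} (hτ : 0 < τ) (v : Phase n) :
    fderiv ℝ (hamiltonian τ) (basePoint n) v = v.2 (ix ⟨0, hn⟩) := by
  simp [fderiv_hamiltonian hτ, rotation_basePoint, fderiv_kinetic_basePoint hn]

theorem fderiv_casimir_basePoint (hn : 0 < n) (v : Phase n) :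
    fderiv ℝ casimir (basePoint n) v = ∑ k : Fin n, (if k.val = 0 then 0 else 2 * v.1 (ix k)) +
      2 * sqRadius (basePoint n) * v.2 (ix ⟨0, hn⟩) := by
  simp only [fderiv_casimir, rotation_basePoint, dilation_basePoint, kinetic_basePoint hn,
    add_apply, sub_apply, smul_apply, fderiv_kinetic_basePoint hn, fderiv_sqRadius]
  simp [basePoint]

theorem fderiv_angularIntegral_basePoint (j : Fin n) (v : Phase n) :
    fderiv ℝ (angularIntegral j) (basePoint n) v =
      if j.val = 0 then -v.1 (iy j) else v.2 (iy j) + 1 / 2 * v.2 iz := by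
  rw [fderiv_angularIntegral]
  by_cases hj : j.val = 0 <;> simp [basePoint, hj]

theorem pairIm_basePoint (a b : Fin n) : pairIm a b (basePoint n) = 0 := by
  simp [pairIm, basePoint]

theorem pairRe_basePoint (hn : 0 < n) {k : Fin n} (hk : 0 < k.val) :
    pairRe ⟨0, hn⟩ k (basePoint n) = -1 := by
  simp [pairRe, basePoint, hk.ne']

theorem fderiv_pairIntegral_basePoint (hn : 0 < n) {k : Fin n} (hk : 0 < k.val) (v : Phase n) :
    fderiv ℝ (pairIntegral ⟨0, hn⟩ k) (basePoint n) v =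
      2 * v.2 (ix ⟨0, hn⟩) + 2 * v.1 (ix k) := by
  simp only [fderiv_pairIntegral, pairIm_basePoint, pairRe_basePoint hn hk, add_apply, smul_apply,
    fderiv_pairRe]
  simp [basePoint, hk.ne']
  ring

theorem differentiableAt_mixedRe_and_fderiv (b k : Fin n) (s : Phase n) :
    DifferentiableAt ℝ (mixedRe b k) s ∧ ∀ v, fderiv ℝ (mixedRe b k) s v =
      v.1 (ix b) * momX k s + s.1 (ix b) * dmomX k s v
        + (v.1 (iy b) * s.2 (iy k) + s.1 (iy b) * v.2 (iy k))
        - (dmomX b s v * s.1 (ix k) + momX b s * v.1 (ix k))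
        - (v.2 (iy b) * s.1 (iy k) + s.2 (iy b) * v.1 (iy k))
        + v.2 iz * (s.1 (iy b) * s.1 (ix k) - s.1 (ix b) * s.1 (iy k))
        + s.2 iz * (v.1 (iy b) * s.1 (ix k) + s.1 (iy b) * v.1 (ix k)
          - (v.1 (ix b) * s.1 (iy k) + s.1 (ix b) * v.1 (iy k))) := by
  have h := (((((hasFDerivAt_q (ix b) s).mul (hasFDerivAt_momX k s)).add
    ((hasFDerivAt_q (iy b) s).mul (hasFDerivAt_p (iy k) s))).sub
    ((hasFDerivAt_momX b s).mul (hasFDerivAt_q (ix k) s))).sub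
    ((hasFDerivAt_p (iy b) s).mul (hasFDerivAt_q (iy k) s))).add
    ((hasFDerivAt_p iz s).mul (((hasFDerivAt_q (iy b) s).mul (hasFDerivAt_q (ix k) s)).sub
      ((hasFDerivAt_q (ix b) s).mul (hasFDerivAt_q (iy k) s))))
  refine ⟨h.differentiableAt, fun v => ?_⟩
  rw [show fderiv ℝ (mixedRe b k) s = _ from h.fderiv]
  simp only [smul_apply, add_apply, sub_apply, dq_apply, dp_apply, smul_eq_mul, Pi.sub_apply,
    Pi.mul_apply, dmomX]
  ring

theorem contDiff_mixedIm {m : WithTop ℕ∞} (b k : Fin n) : ContDiff ℝ m (mixedIm b k) :=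
  (((((contDiff_q _).mul (contDiff_momX k)).sub ((contDiff_q _).mul (contDiff_p _))).sub
    ((contDiff_p _).mul (contDiff_q _))).add ((contDiff_momX b).mul (contDiff_q _))).sub
    ((contDiff_p _).mul (((contDiff_q _).mul (contDiff_q _)).add
      ((contDiff_q _).mul (contDiff_q _))))

theorem mixedRe_basePoint {b k : Fin n} (hb : 0 < b.val) (hk : 0 < k.val) :
    mixedRe b k (basePoint n) = 0 := by
  simp only [mixedRe, momX_basePoint, hb.ne', hk.ne']
  simp [basePoint]

theorem mixedIm_basePoint {b k : Fin n} : mixedIm b k (basePoint n) = 0 := by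
  simp [mixedIm, basePoint]

/-- At the base point `mixedRe` and `mixedIm` vanish, so only their differentials survive. The
coefficient of the first is (-1)(-1) = 1, that of the second is 0 because `pairIm` vanishes; this is
why only `mixedRe` needs an explicit differential. -/
theorem fderiv_bracket_basePoint (hn : 0 < n) {b k : Fin n} (hb : 0 < b.val)
    (hk : b.val < k.val) (v : Phase n) :
    fderiv ℝ (poissonBracket (pairIntegral ⟨0, hn⟩ b) (pairIntegral ⟨0, hn⟩ k)) (basePoint n) v =
      4 * (v.2 (ix k) - v.2 (ix b)) := by
  have hk0 : 0 < k.val := hb.trans hk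
  rw [poissonBracket_pair_pair (by simp [Fin.ext_iff]; omega) (by simp [Fin.ext_iff]; omega)
    (by simp [Fin.ext_iff]; omega)]
  obtain ⟨hM, hMv⟩ := differentiableAt_mixedRe_and_fderiv b k (basePoint n)
  have hI := (contDiff_mixedIm (m := 1) b k).differentiable (by simp) (basePoint n)
  have hr := fun k => (contDiff_pairRe (m := 1) ⟨0, hn⟩ k).differentiable (by simp) (basePoint n)
    |>.hasFDerivAt
  have hi := fun k => (contDiff_pairIm (m := 1) ⟨0, hn⟩ k).differentiable (by simp) (basePoint n)
    |>.hasFDerivAt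
  have h := (((((hr b).mul (hr k)).add ((hi b).mul (hi k))).mul hM.hasFDerivAt).add
    ((((hr b).mul (hi k)).sub ((hi b).mul (hr k))).mul hI.hasFDerivAt)).const_mul (4 : ℝ)
  refine (congrArg (fun L : Phase n →L[ℝ] ℝ => L v) h.fderiv).trans ?_
  simp [mixedRe_basePoint hb hk0, mixedIm_basePoint, pairIm_basePoint, pairRe_basePoint hn hb,
    pairRe_basePoint hn hk0, hMv, momX_basePoint, dmomX_basePoint, hb.ne', hk0.ne']
  simp [basePoint, hb.ne', hk0.ne']

/-! ### Counting labels against the dimension of the phase space -/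

/-- The labels of the first integrals as a disjoint union. -/
def integralIndexEquiv (n : ℕ) : IntegralIndex n ≃
    Option (Option (Fin n ⊕ {k : Fin n // 0 < k.val} ⊕ {k : Fin n // 1 < k.val})) where
  toFun
    | .energy => none
    | .center => some none
    | .angular j => some (some (Sum.inl j))
    | .pair k hk => some (some (Sum.inr (Sum.inl ⟨k, hk⟩)))
    | .bracket k hk => some (some (Sum.inr (Sum.inr ⟨k, hk⟩)))
  invFun
    | none => .energy
    | some none => .center
    | some (some (Sum.inl j)) => .angular j
    | some (some (Sum.inr (Sum.inl k))) => .pair k.1 k.2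
    | some (some (Sum.inr (Sum.inr k))) => .bracket k.1 k.2
  left_inv i := by cases i <;> rfl
  right_inv i := by rcases i with _ | _ | _ | _ | _ <;> rfl

instance : Fintype (IntegralIndex n) := Fintype.ofEquiv _ (integralIndexEquiv n).symm

instance : DecidableEq (IntegralIndex n) := (integralIndexEquiv n).decidableEq

/-- Shifting identifies the indices above `m` with `Fin (n - (m + 1))`. -/
def subtypeLtEquiv (n m : ℕ) : {k : Fin n // m < k.val} ≃ Fin (n - (m + 1)) where
  toFun k := ⟨k.1.val - (m + 1), by have := k.1.2; have := k.2; omega⟩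
  invFun k := ⟨⟨k.val + (m + 1), by have := k.2; omega⟩, show m < k.val + (m + 1) by omega⟩
  left_inv k := by
    have := k.2
    ext
    exact Nat.sub_add_cancel this
  right_inv k := by ext; exact Nat.add_sub_cancel _ _

theorem card_subtype_lt (m : ℕ) : Fintype.card {k : Fin n // m < k.val} = n - (m + 1) := by
  rw [Fintype.card_congr (subtypeLtEquiv n m), Fintype.card_fin]

/-- For n ≥ 2 the sum is (3n - 1) + (n + 3). For n = 1 it is 3 + 3: truncated subtraction makes both
the pair and the bracket labels empty, and there is no Casimir label. -/
theorem card_integralIndex_add_card_centralIndex (hn : 1 ≤ n) :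
    Fintype.card (IntegralIndex n) + Fintype.card (CentralIndex n) =
      Module.finrank ℝ (Phase n) := by
  have h1 : Fintype.card {k : Fin n // k.val = 1} = if 2 ≤ n then 1 else 0 := by
    split_ifs with h
    · exact Fintype.card_eq_one_iff.2 ⟨⟨⟨1, h⟩, rfl⟩, fun k => by ext; exact k.2⟩
    · exact Fintype.card_eq_zero_iff.2 ⟨fun k => by have := k.1.2; have := k.2; omega⟩
  rw [Fintype.card_congr (integralIndexEquiv n)]
  simp only [Fintype.card_option, Fintype.card_sum, card_subtype_lt, h1, Fintype.card_fin,
    Module.finrank_prod, Module.finrank_fintype_fun_eq_card, Fintype.card_unit]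
  split_ifs <;> omega

theorem firstIntegral_det_ne_zero (hn : 0 < n) {τ : ℝ} (hτ : 0 < τ) :
    (Matrix.of fun i j : IntegralIndex n =>
      fderiv ℝ (firstIntegral τ i) (basePoint n) (testVector hn j)).det ≠ 0 := by
  have hH : ∀ v, fderiv ℝ (firstIntegral τ .energy) (basePoint n) v = v.2 (ix ⟨0, hn⟩) :=
    fderiv_hamiltonian_basePoint hn hτ
  have hI : ∀ (j : Fin n) v, fderiv ℝ (firstIntegral τ (.angular j)) (basePoint n) v =
      if j.val = 0 then -v.1 (iy j) else v.2 (iy j) + 1 / 2 * v.2 iz :=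
    fderiv_angularIntegral_basePoint
  have hP : ∀ (k : Fin n) hk v, fderiv ℝ (firstIntegral τ (.pair k hk)) (basePoint n) v =
      2 * v.2 (ix ⟨0, hn⟩) + 2 * v.1 (ix k) :=
    fun k hk => fderiv_pairIntegral_basePoint hn hk
  have hc : ∀ v, fderiv ℝ (firstIntegral τ .center) (basePoint n) v = v.2 iz :=
    fun v => by
      rw [show fderiv ℝ (firstIntegral τ .center) (basePoint n) = _ from fderiv_center _]
      rfl
  have hB : ∀ (k : Fin n) (hk : 1 < k.val) v,
      fderiv ℝ (firstIntegral τ (.bracket k hk)) (basePoint n) v =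
        4 * (v.2 (ix k) - v.2 (ix ⟨1, by omega⟩)) :=
    fun k hk => fderiv_bracket_basePoint hn (b := ⟨1, by omega⟩) Nat.one_pos hk
  -- The only off-diagonal entries come from the p-direction of x_1, seen by the pair rows, and the
  -- p-direction of z, seen by the angular rows. These are the test vectors of the energy and of the
  -- center. The covector of x_2 in the bracket rows is harmless, since no test vector is its
  -- p-direction.
  refine det_ne_zero_of_diagonal_off _ {i | i = .energy ∨ i = .center} ?_ ?_ ?_
  · rintro (_ | j | ⟨k, hk⟩ | _ | ⟨k, hk⟩)
    · simp [hH, testVector]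
    · by_cases hj : j.val = 0 <;> simp [hI, testVector, hj]
    · simp [hP, testVector]
    · simp [hc, testVector]
    · have : k ≠ ⟨1, by omega⟩ := fun h => by simp [h] at hk
      simp [hB, testVector, this.symm]
  · rintro (_ | j | ⟨k, hk⟩ | _ | ⟨k, hk⟩) (_ | j' | ⟨k', hk'⟩ | _ | ⟨k', hk'⟩) hne hS <;>
      simp only [Set.mem_ofPred_eq, reduceCtorEq, or_self, or_true, true_or, not_true,
        not_false_iff] at hS
    · by_cases hj : j'.val = 0 <;> simp [hH, testVector, hj]
    · simp [hH, testVector]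
    · have : k'.val ≠ 0 := by omega
      simp [hH, testVector, Fin.ext_iff, this.symm]
    · have : j ≠ j' := fun h => hne (by rw [h])
      by_cases hj : j.val = 0 <;> by_cases hj' : j'.val = 0 <;>
        simp [hI, testVector, hj, hj', this]
    · by_cases hj : j.val = 0 <;> simp [hI, testVector, hj]
    · by_cases hj : j.val = 0 <;> simp [hI, testVector, hj]
    · by_cases hj' : j'.val = 0 <;> simp [hP, testVector, hj']
    · have : k ≠ k' := fun h => hne (by subst h; rfl)
      simp [hP, testVector, this]
    · have : k'.val ≠ 0 := by omega
      simp [hP, testVector, Fin.ext_iff, this.symm]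
    · by_cases hj' : j'.val = 0 <;> simp [hc, testVector, hj']
    · simp [hc, testVector]
    · simp [hc, testVector]
    · by_cases hj' : j'.val = 0 <;> simp [hB, testVector, hj']
    · simp [hB, testVector]
    · have h1 : k ≠ k' := fun h => hne (by subst h; rfl)
      have h2 : 1 ≠ k'.val := by omega
      simp [hB, testVector, h1, Fin.ext_iff, h2]
  · rintro _ _ hne (rfl | rfl) (rfl | rfl)
    · exact absurd rfl hne
    · simp [hH, testVector]
    · simp [hc, testVector]
    · exact absurd rfl hne

/-- The vectors that separate the differentials of the functions `centralFunction`. -/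
def centralTestVector (hn : 0 < n) : CentralIndex n → Phase n
  | none => testVector hn .energy
  | some none => testVector hn .center
  | some (some (Sum.inl j)) => testVector hn (.angular j)
  | some (some (Sum.inr k)) => (Pi.single (ix k.1) 1, 0)

theorem centralFunction_det_ne_zero (hn : 0 < n) {τ : ℝ} (hτ : 0 < τ) :
    (Matrix.of fun i j : CentralIndex n =>
      fderiv ℝ (centralFunction τ i) (basePoint n) (centralTestVector hn j)).det ≠ 0 := by
  have hH : ∀ v, fderiv ℝ (centralFunction τ none) (basePoint n) v = v.2 (ix ⟨0, hn⟩) :=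
    fderiv_hamiltonian_basePoint hn hτ
  have hI : ∀ (j : Fin n) v,
      fderiv ℝ (centralFunction τ (some (some (Sum.inl j)))) (basePoint n) v =
        if j.val = 0 then -v.1 (iy j) else v.2 (iy j) + 1 / 2 * v.2 iz :=
    fderiv_angularIntegral_basePoint
  have hC : ∀ k v, fderiv ℝ (centralFunction τ (some (some (Sum.inr k)))) (basePoint n) v =
      ∑ k : Fin n, (if k.val = 0 then 0 else 2 * v.1 (ix k)) +
        2 * sqRadius (basePoint n) * v.2 (ix ⟨0, hn⟩) :=
    fun _ => fderiv_casimir_basePoint hn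
  have hc : ∀ v, fderiv ℝ (centralFunction τ (some none)) (basePoint n) v = v.2 iz :=
    fun v => by
      rw [show fderiv ℝ (centralFunction τ (some none)) (basePoint n) = _ from fderiv_center _]
      rfl
  -- The same pattern: the Casimir row has an entry 2R in the energy column and the angular rows an
  -- entry ½ in the center column.
  refine det_ne_zero_of_diagonal_off _ {i | i = none ∨ i = some none} ?_ ?_ ?_
  · rintro (_ | _ | j | ⟨k, hk⟩)
    · simp [hH, centralTestVector, testVector]
    · simp [hc, centralTestVector, testVector]
    · by_cases hj : j.val = 0 <;> simp [hI, centralTestVector, testVector, hj]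
    · simp only [Matrix.of_apply, hC, centralTestVector]
      rw [Finset.sum_eq_single k]
      · simp [hk]
      · intro l _ hl
        simp [hl]
      · simp
  · rintro (_ | _ | j | ⟨k, hk⟩) (_ | _ | j' | ⟨k', hk'⟩) hne hS <;>
      simp only [Set.mem_ofPred_eq, reduceCtorEq, or_self, or_true, true_or, not_true,
        not_false_iff, Option.some.injEq] at hS
    · by_cases hj : j'.val = 0 <;> simp [hH, centralTestVector, testVector, hj]
    · simp [hH, centralTestVector]
    · by_cases hj : j'.val = 0 <;> simp [hc, centralTestVector, testVector, hj]
    · simp [hc, centralTestVector]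
    · have : j ≠ j' := fun h => hne (by rw [h])
      by_cases hj : j.val = 0 <;> by_cases hj' : j'.val = 0 <;>
        simp [hI, centralTestVector, testVector, hj, hj', this]
    · by_cases hj : j.val = 0 <;> simp [hI, centralTestVector, hj]
    · by_cases hj' : j'.val = 0 <;> simp [hC, centralTestVector, testVector, hj']
    -- Both labels have value 1, so there is only one Casimir label.
    · exact absurd (by congr 4; ext; omega) hne
  · rintro _ _ hne (rfl | rfl) (rfl | rfl)
    · exact absurd rfl hne
    · simp [hH, centralTestVector, testVector]
    · simp [hc, centralTestVector, testVector]
    · exact absurd rfl hne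

/-! ### Independence almost everywhere and completeness -/

instance : (MeasureTheory.volume : MeasureTheory.Measure (Phase n)).IsAddHaarMeasure := by
  rw [MeasureTheory.Measure.volume_eq_prod]
  exact MeasureTheory.Measure.prod.instIsAddHaarMeasure _ _

theorem ae_linearIndependent_firstIntegral (hn : 1 ≤ n) {τ : ℝ} (hτ : 0 < τ) :
    ∀ᵐ s : Phase n, LinearIndependent ℝ fun i : IntegralIndex n =>
      fderiv ℝ (firstIntegral τ i) s :=
  (ae_linearIndependent_fderiv MeasureTheory.volume (contDiff_firstIntegral (by simp) hτ)
    (basePoint n) (testVector hn) (firstIntegral_det_ne_zero hn hτ)).1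

/-- The Casimir function is never shown to lie in the algebra. It is enough that it commutes with
the generators; the dimension count then puts its differential into F_s at generic points. -/
theorem isIntegrableBy_firstIntegral (hn : 1 ≤ n) {τ : ℝ} (hτ : 0 < τ) :
    IsIntegrableBy (hamiltonian τ) (poissonAlgebra (Set.range (firstIntegral (n := n) τ))) := by
  have hle : poissonAlgebra (Set.range (firstIntegral (n := n) τ)) ≤
      centralizer (Set.range (centralFunction τ)) := by
    refine poissonAlgebra_le_centralizer ?_ ?_
    · rintro _ ⟨i, rfl⟩
      exact contDiff_centralFunction hτ i
    · rintro _ ⟨i, rfl⟩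
      refine mem_centralizer.2 ⟨contDiff_firstIntegral le_rfl hτ i, ?_⟩
      rintro _ ⟨j, rfl⟩
      exact poissonBracket_firstIntegral_central hτ i j
  refine ⟨fun f hf => (hle hf).1, fun f hf g hg => poissonBracket_mem_poissonAlgebra hf hg,
    fun f hf => (hle hf).2 _ ⟨none, rfl⟩, ?_⟩
  obtain ⟨U, hUo, hUd, hU⟩ := (ae_linearIndependent_fderiv MeasureTheory.volume
    (contDiff_firstIntegral (by simp) hτ) (basePoint n) (testVector hn)
    (firstIntegral_det_ne_zero hn hτ)).2
  obtain ⟨V, hVo, hVd, hV⟩ := (ae_linearIndependent_fderiv MeasureTheory.volume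
    (contDiff_centralFunction hτ) (basePoint n) (centralTestVector hn)
    (centralFunction_det_ne_zero hn hτ)).2
  have hcard := card_integralIndex_add_card_centralIndex hn
  refine ⟨_, _, U ∩ V, hUo.inter hVo, hUd.inter_of_isOpen_left hVd hUo, fun s hs => ?_, hcard⟩
  exact finrank_differentials (fun i => subset_poissonAlgebra _ ⟨i, rfl⟩)
    (fun h hh j => congrFun ((hle hh).2 _ ⟨j, rfl⟩) s)
    (fun i j => congrFun (poissonBracket_central_central hτ i j) s) (hU s hs.1) (hV s hs.2) hcard

/-! ### The sub-Riemannian structure and its normal geodesics -/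

/-- The component along `J q` of the horizontal velocity, up to sign. -/
def spin (τ : ℝ) (s : Phase n) : ℝ := τ * rotation s / (1 + τ * sqRadius s)

/-- The velocity that corresponds to a covector. -/
def velocity (τ : ℝ) (s : Phase n) : Point n :=
  Sum.elim (Sum.elim (fun k => momX k s + spin τ s * s.1 (iy k))
      fun k => s.2 (iy k) - spin τ s * s.1 (ix k))
    fun _ => ∑ k, s.1 (iy k) * (momX k s + spin τ s * s.1 (iy k))

theorem sharp_hamiltonian {τ : ℝ} (hτ : 0 < τ) (s : Phase n) :
    sharp (fderiv ℝ (hamiltonian τ) s) = (velocity τ s,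
      Sum.elim (Sum.elim (fun k => spin τ s * (s.2 (iy k) - spin τ s * s.1 (ix k)))
        fun k => -((s.2 iz + spin τ s) * (momX k s + spin τ s * s.1 (iy k)))) fun _ => 0) := by
  rw [fderiv_hamiltonian hτ, sharp_add, sharp_sub, sharp_smul, sharp_smul, sharp_kinetic,
    sharp_rotation, sharp_sqRadius, ← spin]
  ext ((k | k) | k)
  · simp [velocity]
  · simp [velocity]
  · simp only [velocity, Prod.fst_add, Prod.fst_sub, Prod.smul_fst, Pi.add_apply, Pi.sub_apply,
      Pi.smul_apply, Sum.elim_inr, smul_eq_mul, Pi.zero_apply, Finset.mul_sum, mul_add,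
      Finset.sum_add_distrib, mul_neg, mul_zero, add_zero, sub_neg_eq_add, add_right_inj]
    exact Finset.sum_congr rfl fun k _ => by ring
  · simp; ring
  · simp; ring
  · simp

/-! ### The metric on the distribution and the Legendre transform -/

theorem mem_rightDistribution_iff (q v : Point n) :
    v ∈ rightDistribution q ↔ v iz = ∑ k, q (iy k) * v (ix k) := by
  rw [mem_rightDistribution]
  simp only [rightForm, dotProduct, Fintype.sum_sum_type, Sum.elim_inl, Sum.elim_inr, neg_mul,
    zero_mul, Finset.sum_const_zero, add_zero, Finset.sum_neg_distrib, Finset.univ_unique,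
    Finset.sum_singleton, one_mul]
  constructor <;> intro h <;> linarith [h]

/-- The vertical component of a tangent vector in the left-invariant frame. -/
def leftVertical (q v : Point n) : ℝ := v iz - ∑ k, q (ix k) * v (iy k)

/-- In the left-invariant frame the horizontal components of a vector are its coordinates, and the
metric is diagonal with entries 1 and τ. -/
theorem dotProduct_leftMetric (τ : ℝ) (q v w : Point n) :
    v ⬝ᵥ leftMetric (fun _ => 1) τ q *ᵥ w =
      ∑ k, (v (ix k) * w (ix k) + v (iy k) * w (iy k)) +
        τ * leftVertical q v * leftVertical q w := by
  have h : ∀ v : Point n, leftPush q (Sum.elim (fun i => v (Sum.inl i))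
      fun _ => leftVertical q v) = v := by
    intro v
    rw [leftPush_apply]
    ext (i | i)
    · rfl
    · simp [leftVertical]
  conv_lhs => rw [← h v, ← h w]
  rw [leftMetric_leftPush]
  simp [Finset.sum_add_distrib]

theorem leftVertical_of_mem {q v : Point n} (hv : v ∈ rightDistribution q) :
    leftVertical q v = ∑ k, (q (iy k) * v (ix k) - q (ix k) * v (iy k)) := by
  rw [leftVertical, (mem_rightDistribution_iff q v).1 hv, Finset.sum_sub_distrib]

theorem velocity_mem (τ : ℝ) (s : Phase n) : velocity τ s ∈ rightDistribution s.1 :=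
  (mem_rightDistribution_iff _ _).2 rfl

/-- On D_R the left vertical component of v is -⟨v, Jq⟩, so the restricted metric is E + τ(Jq)(Jq)ᵀ
in the coordinates (x, y). Inverting this rank-one perturbation produces the factor τ/(1 + τR) in
`spin`. -/
theorem leftVertical_velocity {τ : ℝ} (hτ : 0 < τ) (s : Phase n) :
    τ * leftVertical s.1 (velocity τ s) = -spin τ s := by
  have h : leftVertical s.1 (velocity τ s) = spin τ s * sqRadius s - rotation s := by
    rw [leftVertical_of_mem (velocity_mem τ s), sqRadius, rotation, Finset.mul_sum,
      ← Finset.sum_sub_distrib]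
    exact Finset.sum_congr rfl fun k _ => by simp [velocity]; ring
  have hpos := (one_add_pos hτ s).ne'
  rw [h, spin]
  field_simp
  ring

theorem constrainedLagrangian_eq (τ μ : ℝ) :
    constrainedLagrangian (leftMetric (fun _ => 1) τ) rightForm μ = fun s : Phase n =>
      1 / 2 * (∑ k, (s.2 (ix k) ^ 2 + s.2 (iy k) ^ 2) +
        τ * (s.2 iz - ∑ k, s.1 (ix k) * s.2 (iy k)) ^ 2) +
        μ * (s.2 iz - ∑ k, s.1 (iy k) * s.2 (ix k)) := by
  funext s
  have h : rightForm s.1 ⬝ᵥ s.2 = s.2 iz - ∑ k, s.1 (iy k) * s.2 (ix k) := by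
    simp [rightForm, dotProduct, Finset.sum_neg_distrib]
    ring
  rw [constrainedLagrangian, dotProduct_leftMetric, h]
  simp only [leftVertical, sq, mul_assoc]

theorem fderiv_constrainedLagrangian (τ μ : ℝ) (s v : Phase n) :
    fderiv ℝ (constrainedLagrangian (leftMetric (fun _ => 1) τ) rightForm μ) s v =
      ∑ k, (s.2 (ix k) * v.2 (ix k) + s.2 (iy k) * v.2 (iy k)) +
        τ * leftVertical s.1 s.2 *
          (v.2 iz - ∑ k, (v.1 (ix k) * s.2 (iy k) + s.1 (ix k) * v.2 (iy k))) +
        μ * (v.2 iz - ∑ k, (v.1 (iy k) * s.2 (ix k) + s.1 (iy k) * v.2 (ix k))) := by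
  have h1 := HasFDerivAt.fun_sum (u := Finset.univ) fun k (_ : k ∈ Finset.univ) =>
    ((hasFDerivAt_p (ix k) s).pow 2).add ((hasFDerivAt_p (iy k) s).pow 2)
  have h2 := (hasFDerivAt_p iz s).sub (HasFDerivAt.fun_sum (u := Finset.univ)
    fun k (_ : k ∈ Finset.univ) => (hasFDerivAt_q (ix k) s).mul (hasFDerivAt_p (iy k) s))
  have h3 := (hasFDerivAt_p iz s).sub (HasFDerivAt.fun_sum (u := Finset.univ)
    fun k (_ : k ∈ Finset.univ) => (hasFDerivAt_q (iy k) s).mul (hasFDerivAt_p (ix k) s))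
  have h := ((h1.add ((h2.pow 2).const_mul τ)).const_mul (1 / 2 : ℝ)).add (h3.const_mul μ)
  rw [constrainedLagrangian_eq]
  refine (congrArg (fun L : Phase n →L[ℝ] ℝ => L v) h.fderiv).trans ?_
  have e1 : ∑ k, (s.2 (ix k) * v.2 (ix k) + s.2 (iy k) * v.2 (iy k)) =
      1 / 2 * ∑ k, (2 * s.2 (ix k) * v.2 (ix k) + 2 * s.2 (iy k) * v.2 (iy k)) := by
    rw [Finset.mul_sum]
    exact Finset.sum_congr rfl fun k _ => by ring
  have e2 : ∑ k, (v.1 (ix k) * s.2 (iy k) + s.1 (ix k) * v.2 (iy k)) =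
      ∑ k, (s.1 (ix k) * v.2 (iy k) + s.2 (iy k) * v.1 (ix k)) :=
    Finset.sum_congr rfl fun k _ => by ring
  have e3 : ∑ k, (v.1 (iy k) * s.2 (ix k) + s.1 (iy k) * v.2 (ix k)) =
      ∑ k, (s.1 (iy k) * v.2 (ix k) + s.2 (ix k) * v.1 (iy k)) :=
    Finset.sum_congr rfl fun k _ => by ring
  rw [e1, e2, e3]
  simp [leftVertical]
  ring

theorem sharp_constrainedLagrangian (τ μ : ℝ) (s : Phase n) :
    sharp (fderiv ℝ (constrainedLagrangian (leftMetric (fun _ => 1) τ) rightForm μ) s) =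
      (Sum.elim (Sum.elim (fun k => s.2 (ix k) - μ * s.1 (iy k))
          fun k => s.2 (iy k) - τ * leftVertical s.1 s.2 * s.1 (ix k))
          fun _ => τ * leftVertical s.1 s.2 + μ,
        Sum.elim (Sum.elim (fun k => τ * leftVertical s.1 s.2 * s.2 (iy k))
          fun k => μ * s.2 (ix k)) fun _ => 0) := by
  ext ((k | k) | k) <;>
    simp [sharp, fderiv_constrainedLagrangian, Pi.single_apply] <;> ring

/-- The Legendre transform of a horizontal velocity. -/
theorem sharp_hamiltonian_legendre {τ : ℝ} (hτ : 0 < τ) (μ : ℝ) {q v : Point n}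
    (hv : v ∈ rightDistribution q) :
    sharp (fderiv ℝ (hamiltonian τ) (q, (sharp (fderiv ℝ
        (constrainedLagrangian (leftMetric (fun _ => 1) τ) rightForm μ) (q, v))).1)) =
      (v, -(sharp (fderiv ℝ
        (constrainedLagrangian (leftMetric (fun _ => 1) τ) rightForm μ) (q, v))).2) := by
  rw [sharp_constrainedLagrangian, sharp_hamiltonian hτ]
  set w := leftVertical q v with hw
  set p : Point n := Sum.elim (Sum.elim (fun k => v (ix k) - μ * q (iy k))
          fun k => v (iy k) - τ * w * q (ix k)) fun _ => τ * w + μ with hp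
  have hX : ∀ k, momX k (q, p) = v (ix k) + τ * w * q (iy k) := fun k => by
    simp [momX, hp]; ring
  have hK : rotation (q, p) = -w * (1 + τ * sqRadius (q, p)) := by
    have : w = ∑ k, (q (iy k) * v (ix k) - q (ix k) * v (iy k)) := leftVertical_of_mem hv
    have h2 : rotation (q, p) = -(∑ k, (q (iy k) * v (ix k) - q (ix k) * v (iy k))) -
        τ * w * sqRadius (q, p) := by
      simp only [rotation, sqRadius, Finset.mul_sum, ← Finset.sum_neg_distrib,
        ← Finset.sum_sub_distrib, hX]
      exact Finset.sum_congr rfl fun k _ => by simp [hp]; ring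
    rw [h2, ← this]
    ring
  have hspin : spin τ (q, p) = -(τ * w) := by
    have hpos := (one_add_pos hτ (q, p)).ne'
    rw [spin, hK]
    field_simp
  have hvz := (mem_rightDistribution_iff q v).1 hv
  have hpy : ∀ k, p (iy k) = v (iy k) - τ * w * q (ix k) := fun _ => rfl
  have hpz : p iz = τ * w + μ := rfl
  ext ((k | k) | k)
  · simp [velocity, hX, hspin]
  · simp [velocity, hspin, hpy]
  · simp [velocity, hX, hspin, hvz]
  · simp [hspin, hpy]
  · simp [hspin, hX, hpz]
  · simp

/-- The inverse Legendre transform, with multiplier `λ_{2n+1} + spin`. -/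
theorem sharp_constrainedLagrangian_velocity {τ : ℝ} (hτ : 0 < τ) (s : Phase n) :
    (sharp (fderiv ℝ (constrainedLagrangian (leftMetric (fun _ => 1) τ) rightForm
      (s.2 iz + spin τ s)) (s.1, velocity τ s))).1 = s.2 := by
  rw [sharp_constrainedLagrangian]
  simp only [leftVertical_velocity hτ]
  ext ((k | k) | k)
  · simp [velocity, momX]; ring
  · simp [velocity]
  · simp

/-- The cometric map is `velocity`: its horizontal part is P - σJq with σ = `spin`, the inverse of E
+ τ(Jq)(Jq)ᵀ applied to P. Pairing with a horizontal vector sees only P, because the z-component of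
the vector turns λ_k into λ_k + y_k λ_{2n+1}. -/
theorem isSubRiemannianHamiltonian {τ : ℝ} (hτ : 0 < τ) :
    IsSubRiemannianHamiltonian (rightDistribution (n := n)) (leftMetric (fun _ => 1) τ)
      (hamiltonian τ) := by
  have hXadd : ∀ (q p p' : Point n) k, momX k (q, p + p') = momX k (q, p) + momX k (q, p') :=
    fun q p p' k => by simp [momX]; ring
  have hXsmul : ∀ (q p : Point n) (r : ℝ) k, momX k (q, r • p) = r * momX k (q, p) :=
    fun q p r k => by simp [momX]; ring
  have hadd : ∀ q p p' : Point n, spin τ (q, p + p') = spin τ (q, p) + spin τ (q, p') := by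
    intro q p p'
    have : rotation (q, p + p') = rotation (q, p) + rotation (q, p') := by
      simp only [rotation, hXadd, ← Finset.sum_add_distrib]
      exact Finset.sum_congr rfl fun k _ => by simp; ring
    rw [spin, this, spin, spin, show sqRadius (q, p + p') = sqRadius (q, p) from rfl,
      show sqRadius (q, p') = sqRadius (q, p) from rfl]
    ring
  have hsmul : ∀ (q p : Point n) (r : ℝ), spin τ (q, r • p) = r * spin τ (q, p) := by
    intro q p r
    have : rotation (q, r • p) = r * rotation (q, p) := by
      simp only [rotation, hXsmul, Finset.mul_sum]
      exact Finset.sum_congr rfl fun k _ => by simp; ring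
    rw [spin, this, spin, show sqRadius (q, r • p) = sqRadius (q, p) from rfl]
    ring
  have hdot : ∀ {q p v : Point n}, v ∈ rightDistribution q →
      p ⬝ᵥ v = ∑ k, (momX k (q, p) * v (ix k) + p (iy k) * v (iy k)) := by
    intro q p v hv
    have hvz := (mem_rightDistribution_iff q v).1 hv
    simp only [dotProduct, Fintype.sum_sum_type, Finset.univ_unique, Finset.sum_singleton]
    rw [show v (Sum.inr default) = _ from hvz, Finset.mul_sum, ← Finset.sum_add_distrib,
      ← Finset.sum_add_distrib]
    exact Finset.sum_congr rfl fun k _ => by simp only [momX]; ring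
  refine ⟨fun q =>
    { toFun := fun p => velocity τ (q, p)
      map_add' := fun p p' => ?_
      map_smul' := fun r p => ?_ }, fun q => ⟨?_, fun p v hv => ?_⟩, fun q p => ?_⟩
  · ext ((k | k) | k)
    · simp [velocity, hXadd, hadd]; ring
    · simp [velocity, hadd]; ring
    · simp only [velocity, hXadd, hadd, Pi.add_apply, Sum.elim_inr, ← Finset.sum_add_distrib]
      exact Finset.sum_congr rfl fun k _ => by ring
  · ext ((k | k) | k)
    · simp [velocity, hXsmul, hsmul]; ring
    · simp [velocity, hsmul]; ring
    · simp only [velocity, hXsmul, hsmul, Pi.smul_apply, Sum.elim_inr, Finset.mul_sum,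
        RingHom.id_apply, smul_eq_mul]
      exact Finset.sum_congr rfl fun k _ => by ring
  · ext v
    constructor
    · rintro ⟨p, rfl⟩
      exact velocity_mem τ (q, p)
    · intro hv
      -- Surjectivity onto D_R: the Legendre transform of v, with any multiplier, is a preimage of
      -- v; the multiplier 0 is taken.
      have h := sharp_hamiltonian_legendre hτ 0 hv
      rw [sharp_hamiltonian hτ] at h
      exact ⟨_, congrArg Prod.fst h⟩
  · change p ⬝ᵥ v = velocity τ (q, p) ⬝ᵥ _
    rw [dotProduct_leftMetric, leftVertical_velocity hτ (q, p), leftVertical_of_mem hv, hdot hv,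
      Finset.mul_sum, ← Finset.sum_add_distrib]
    exact Finset.sum_congr rfl fun k _ => by simp [velocity]; ring
  · change _ = 1 / 2 * (p ⬝ᵥ velocity τ (q, p))
    have h : ∑ k, (momX k (q, p) * velocity τ (q, p) (ix k) +
        p (iy k) * velocity τ (q, p) (iy k)) =
        2 * kinetic (q, p) - spin τ (q, p) * rotation (q, p) := by
      simp only [kinetic, rotation, Finset.mul_sum, ← Finset.sum_sub_distrib]
      exact Finset.sum_congr rfl fun k _ => by simp [velocity]; ring
    rw [hdot (velocity_mem τ (q, p)), h, hamiltonian_eq, spin]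
    ring

/-- With p = ∂L/∂v, the first half of Hamilton's equations expresses horizontality and the inverse
Legendre transform, and the second half is the Euler–Lagrange equation because ∂H/∂q = -∂L/∂q. The
two directions use the transform and its inverse, so no regularity of μ has to be established. -/
theorem isNormalGeodesic_iff {τ : ℝ} (hτ : 0 < τ) {T : Set ℝ} (hT : IsOpen T)
    (γ : ℝ → Point n) :
    IsNormalGeodesic rightDistribution (leftMetric (fun _ => 1) τ) rightForm T γ ↔
      ∃ p : ℝ → Point n, IsHamiltonianTrajectory (hamiltonian τ) T γ p := by
  constructor
  · rintro ⟨hγ, μ, hμ⟩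
    refine ⟨fun t => (sharp (fderiv ℝ (constrainedLagrangian (leftMetric (fun _ => 1) τ)
      rightForm (μ t)) (γ t, deriv γ t))).1, fun t ht i => ?_⟩
    have hL := sharp_hamiltonian_legendre hτ (μ t) (hγ t ht).2
    have h1 := congrFun (congrArg Prod.fst hL) i
    have h2 := congrFun (congrArg Prod.snd hL) i
    have hd := hasDerivAt_pi.1 (hγ t ht).1.hasDerivAt i
    refine ⟨?_, ?_⟩
    · exact hd.congr_deriv h1.symm
    · refine (hμ t ht i).congr_deriv ?_
      refine Eq.trans ?_ h2.symm
      simp [sharp, partialFst]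
  · rintro ⟨p, hp⟩
    have hderiv : ∀ t ∈ T, HasDerivAt γ (velocity τ (γ t, p t)) t := by
      intro t ht
      refine hasDerivAt_pi.2 fun i => ?_
      have h := (hp t ht i).1
      rwa [show partialSnd i (hamiltonian τ) (γ t, p t) = velocity τ (γ t, p t) i from
        congrFun (congrArg Prod.fst (sharp_hamiltonian hτ (γ t, p t))) i] at h
    refine ⟨fun t ht => ⟨(hderiv t ht).differentiableAt, ?_⟩,
      -- The z-component of ∂L/∂v is τw + μ with w the left vertical velocity, and τw = -`spin`;
      -- this forces the multiplier.
      fun t => p t iz + spin τ (γ t, p t), fun t ht i => ?_⟩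
    · rw [(hderiv t ht).deriv]
      exact velocity_mem τ (γ t, p t)
    · have hinv : ∀ t ∈ T, (sharp (fderiv ℝ (constrainedLagrangian (leftMetric (fun _ => 1) τ)
          rightForm (p t iz + spin τ (γ t, p t))) (γ t, deriv γ t))).1 = p t := fun t ht => by
        rw [(hderiv t ht).deriv]
        exact sharp_constrainedLagrangian_velocity hτ (γ t, p t)
      -- The momentum ∂L/∂v equals p only at times in T, so openness of T is what allows the
      -- derivative of p to be transferred to it.
      have heq : (fun s => partialSnd i (constrainedLagrangian (leftMetric (fun _ => 1) τ)
          rightForm (p s iz + spin τ (γ s, p s))) (γ s, deriv γ s)) =ᶠ[nhds t] fun s => p s i := by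
        filter_upwards [hT.mem_nhds ht] with s hs
        exact congrFun (hinv s hs) i
      refine HasDerivAt.congr_of_eventuallyEq ?_ heq
      refine (hp t ht i).2.congr_deriv ?_
      have hmem : deriv γ t ∈ rightDistribution (γ t) := by
        rw [(hderiv t ht).deriv]
        exact velocity_mem τ (γ t, p t)
      have hL := sharp_hamiltonian_legendre hτ (p t iz + spin τ (γ t, p t)) hmem
      rw [hinv t ht] at hL
      refine (congrFun (congrArg Prod.snd hL) i).trans ?_
      simp [sharp, partialFst]

end Heis

end

theorem proposition3p5 (n : ℕ) (hn : 1 ≤ n) (τ : ℝ) (hτ : 0 < τ) :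
    -- the sub-Riemannian Hamiltonian
    Heis.IsSubRiemannianHamiltonian (Heis.rightDistribution (n := n))
      (Heis.leftMetric (fun _ => 1) τ) (Heis.hamiltonian τ) ∧
    -- the normal geodesics are exactly the projections of the Hamiltonian trajectories
    (∀ T : Set ℝ, IsOpen T → T.OrdConnected → ∀ γ : ℝ → Heis.Point n,
      Heis.IsNormalGeodesic Heis.rightDistribution (Heis.leftMetric (fun _ => 1) τ)
          Heis.rightForm T γ ↔
        ∃ p : ℝ → Heis.Point n, Heis.IsHamiltonianTrajectory (Heis.hamiltonian τ) T γ p) ∧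
    -- smooth first integrals
    (∀ i : Heis.IntegralIndex n, ContDiff ℝ ∞ (Heis.firstIntegral τ i) ∧
      Heis.poissonBracket (Heis.firstIntegral τ i) (Heis.hamiltonian τ) = 0) ∧
    -- functional independence almost everywhere
    (∀ᵐ s : Heis.Phase n, LinearIndependent ℝ
      fun i : Heis.IntegralIndex n => fderiv ℝ (Heis.firstIntegral τ i) s) ∧
    -- integrability by means of the Lie algebra that they generate
    Heis.IsIntegrableBy (Heis.hamiltonian τ)
      (Heis.poissonAlgebra (Set.range (Heis.firstIntegral (n := n) τ))) ∧
    -- which is commutative for `n = 1` and `n = 2`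
    (n ≤ 2 → ∀ i j : Heis.IntegralIndex n,
      Heis.poissonBracket (Heis.firstIntegral τ i) (Heis.firstIntegral τ j) = 0) := by
  refine ⟨Heis.isSubRiemannianHamiltonian hτ, fun T hT _ γ => Heis.isNormalGeodesic_iff hτ hT γ,
    fun i => ⟨Heis.contDiff_firstIntegral le_rfl hτ i,
      Heis.poissonBracket_firstIntegral_central hτ i none⟩,
    Heis.ae_linearIndependent_firstIntegral hn hτ, Heis.isIntegrableBy_firstIntegral hn hτ,
    fun hn2 => Heis.poissonBracket_firstIntegral_firstIntegral hn2 hτ⟩
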